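/- Bit strings are vectors over $\mathbb F_2$, $\oplus$ is bitwise XOR, $(v)_i^{j}$ denotes the bits $i,\dots,j$ of $v$ (indices start at $0$), and $(a\|b)$ is concatenation. **Security notions.** Let $E$ be a quantum system with an arbitrary complex Hilbert space $\mathcal H_E$, and let $\rho_{XE}=\sum_x p(x)\,|x\rangle\langle x|\otimes\rho_E(x)$ be a classical-quantum state. Its conditional min-entropy, in bits, is $$H_{\min}(X|E)_\rho=\sup\{\lambda\in\mathbb R:\ \rho_{XE}\le 2^{-\lambda}\,\mathbb I\otimes\sigma\text{ for some density operator }\sigma\text{ on }\mathcal H_E\}.$$ Write $\|\cdot\|_1$ for the trace norm, and let $\omega_A$ be the maximally mixed state (uniform distribution) of a classical register $A$. Let $\mathrm{Ext}(x,s)$ be a function whose seed $S$ is uniform and independent of $XE$, with output $Z=\mathrm{Ext}(X,S)$, and let $S'=\mathrm{next}(X,S)$ be an outgoing seed of the same length as $S$. For $k\in\mathbb R$ and $\varepsilon\ge 0$ we say: 1. $\mathrm{Ext}$ is a *quantum-proof $(k,\varepsilon)$-extractor* if $\tfrac12\|\rho_{ZE}-\omega_Z\otimes\rho_E\|_1\le\varepsilon$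 for every $\rho_{XE}$ with $H_{\min}(X|E)_\rho\ge k$. 2. It is *strong in the outgoing seed* if $\tfrac12\|\rho_{ZS'E}-\omega_Z\otimes\omega_S\otimes\rho_E\|_1\le\varepsilon$ for every such $\rho_{XE}$. 3. It is *$\varepsilon$-secure under re-use of the seed* if the following holds for every $\rho_{X_1X_2E}$ (classical in $X_1,X_2$) with $H_{\min}(X_1|X_2E)_\rho\ge k$ and $H_{\min}(X_2|E)_\rho\ge k$. Put $Z_1=\mathrm{Ext}(X_1,S)$, $S'=\mathrm{next}(X_1,S)$, $Z_2=\mathrm{Ext}(X_2,S')$ and $S''=\mathrm{next}(X_2,S')$. Then $\tfrac12\|\rho_{Z_1Z_2S''E}-\omega_{Z}\otimes\omega_{Z}\otimes\omega_S\otimes\rho_E\|_1\le\varepsilon$. **Stream extractors.** Each uses a seed $(r\|y)$ to compute a mask $w$ of the same length $N$ as the raw data $x$, and outputs $z=(x\oplus w)_0^{m-1}$. The outgoing seed is $(r'\|y)$, where $r'=(x\oplus w)_m^{N-1}$ consists of the last $N-m$ bits of $x\oplus w$, and $y$ is kept. * $\mathrm{StreamC}$: let $n$ be a prime with primitive root $2$,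 $0\le m\le n-1$, $N=n-1$, $r\in\{0,1\}^{n-m-1}$ and $y\in\{0,1\}^{n}$. The mask is $w=(C_{\tilde r}\,y)_0^{n-2}$, where $\tilde r=(r\|0^{m+1})$ and $C_{\tilde r}$ is the $n\times n$ circulant matrix with entries $(C_{\tilde r})_{ij}=\tilde r_{(j-i)\bmod n}$. * $\mathrm{StreamM}$: let $n\ge1$, $0\le m\le n$, $N=n$, $r\in\{0,1\}^{n-m}$ and $y=(y_{1+m-n},\dots,y_{m-1})\in\{0,1\}^{n-1}$. The mask is $w=(M_y,\mathbb I_{n-m})^{\mathrm T}r$, where $M_y$ is the $(n-m)\times m$ Toeplitz matrix with entries $(M_y)_{ij}=y_{j-i}$. **Claim.** For every real $k$, with $\varepsilon=2^{(m-k)/2}$ (the soundness parameter of the corresponding block extractors), both $\mathrm{StreamC}$ and $\mathrm{StreamM}$ are quantum-proof $(k,\varepsilon)$-extractors, are strong in the outgoing seed with the same $k$ and $\varepsilon$, and are $2\varepsilon$-secure under re-use of the seed (with the same $k$). -/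

import Mathlib

open scoped ENNReal Matrix

namespace StreamExtraction

noncomputable section

/-! ### Operators, trace norm and classical-quantum states -/

/-- Bounded operators on a complex Hilbert space. -/
abbrev Op (H : Type*) [NormedAddCommGroup H] [InnerProductSpace ℂ H] := H →L[ℂ] H

/-- The trace norm `‖T‖₁ = Tr |T|` of a bounded operator, in its variational form: the supremum of
`∑ i, |⟪f i, T (e i)⟫|` over all finite orthonormal systems `e`, `f` of equal length. It is `∞`
exactly when `T` is not trace class. -/
def traceNorm {H : Type*} [NormedAddCommGroup H] [InnerProductSpace ℂ H] (T : Op H) : ℝ≥0∞ :=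
  ⨆ (l : ℕ) (e : Fin l → H) (f : Fin l → H) (_ : Orthonormal ℂ e) (_ : Orthonormal ℂ f),
    ∑ i, ‖inner ℂ (f i) (T (e i))‖ₑ

/-- Density operators: positive operators of trace one (the trace norm of a positive operator is
its trace). -/
def IsDensity {H : Type*} [NormedAddCommGroup H] [InnerProductSpace ℂ H] (T : Op H) : Prop :=
  T.IsPositive ∧ traceNorm T = 1

/-- The Hilbert space `ℂ^X ⊗ H`, realised as the `ℓ²`-direct sum of copies of `H` indexed by `X`:
the joint system of a classical register with values in `X` and a quantum system `H`. -/
abbrev Joint (X H : Type*) := PiLp 2 (fun _ : X => H)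

/-- The operator `∑ x, |x⟩⟨x| ⊗ T x` on `ℂ^X ⊗ H`. -/
def cqOp {X H : Type*} [Fintype X] [NormedAddCommGroup H] [InnerProductSpace ℂ H]
    (T : X → Op H) : Op (Joint X H) :=
  (PiLp.continuousLinearEquiv 2 ℂ (fun _ : X => H)).symm.toContinuousLinearMap ∘L
    ContinuousLinearMap.pi (fun x => T x ∘L ContinuousLinearMap.proj x) ∘L
      (PiLp.continuousLinearEquiv 2 ℂ (fun _ : X => H)).toContinuousLinearMap

/-- `ρ x = p(x) ρ_E(x)`, `x ∈ X`, are the blocks of a classical-quantum state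
`ρ_XE = ∑ x, p(x) |x⟩⟨x| ⊗ ρ_E(x)`. -/
def IsCQState {X H : Type*} [Fintype X] [NormedAddCommGroup H] [InnerProductSpace ℂ H]
    (ρ : X → Op H) : Prop :=
  IsDensity (cqOp ρ)

/-- The reduced state `ρ_E` of a classical-quantum state. -/
def marginal {X H : Type*} [Fintype X] [NormedAddCommGroup H] [InnerProductSpace ℂ H]
    (ρ : X → Op H) : Op H :=
  ∑ x, ρ x

/-- The conditional min-entropy `H_min(X|E)_ρ` in bits: the supremum of all real `l` such that
`ρ_XE ≤ 2^(-l) I ⊗ σ` for some density operator `σ` on the system `E`. -/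
def condMinEntropy {X H : Type*} [Fintype X] [NormedAddCommGroup H] [InnerProductSpace ℂ H]
    (ρ : X → Op H) : ℝ :=
  sSup {l : ℝ | ∃ σ : Op H, IsDensity σ ∧
    cqOp ρ ≤ (((2 : ℝ) ^ (-l) : ℝ) : ℂ) • cqOp (fun _ : X => σ)}

/-- The trace distance `½ ‖A - B‖₁` of two classical-quantum operators. -/
def traceDist {X H : Type*} [Fintype X] [NormedAddCommGroup H] [InnerProductSpace ℂ H]
    (A B : X → Op H) : ℝ≥0∞ :=
  2⁻¹ * traceNorm (cqOp A - cqOp B)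

/-- The joint state of `g(X, S)` and `E`, where `S` is a uniformly distributed seed that is
independent of the classical-quantum state `ρ_XE`. -/
def seeded {X S O H : Type*} [Fintype X] [Fintype S] [DecidableEq O]
    [NormedAddCommGroup H] [InnerProductSpace ℂ H]
    (ρ : X → Op H) (g : X → S → O) : O → Op H :=
  fun o => ∑ x, ∑ s, if g x s = o then ((Fintype.card S : ℂ)⁻¹) • ρ x else 0

/-- The state `I/|O| ⊗ τ`: a uniformly distributed `O`-valued register next to `τ`. -/
def uniformWith {H : Type*} (O : Type*) [Fintype O]
    [NormedAddCommGroup H] [InnerProductSpace ℂ H] (τ : Op H) : O → Op H :=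
  fun _ => ((Fintype.card O : ℂ)⁻¹) • τ

/-! ### Quantum-proof extractors -/

/-- `ext` is a quantum-proof extractor: if `H_min(X|E) ≥ k` then `ext(X, S)`, for a uniform seed
`S`, is `ε`-close to uniform and independent of `E`. -/
def IsQuantumProofExtractor.{u} {X S Z : Type} [Fintype X] [Fintype S] [Fintype Z] [DecidableEq Z]
    (ext : X → S → Z) (k ε : ℝ) : Prop :=
  ∀ (H : Type u) [NormedAddCommGroup H] [InnerProductSpace ℂ H] [CompleteSpace H] (ρ : X → Op H),
    IsCQState ρ → k ≤ condMinEntropy ρ →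
      traceDist (seeded ρ ext) (uniformWith Z (marginal ρ)) ≤ ENNReal.ofReal ε

/-- `ext` is a quantum-proof extractor that is strong with respect to the outgoing seed
`next(X, S)`: if `H_min(X|E) ≥ k`, then output, outgoing seed and `E` are jointly `ε`-close to
`I/|Z| ⊗ I/|S| ⊗ ρ_E`. For `next x s = s` this is the usual notion of a strong extractor. -/
def IsQuantumProofStrongExtractor.{u} {X S Z : Type} [Fintype X] [Fintype S] [Fintype Z]
    [DecidableEq S] [DecidableEq Z] (ext : X → S → Z) (next : X → S → S) (k ε : ℝ) : Prop :=
  ∀ (H : Type u) [NormedAddCommGroup H] [InnerProductSpace ℂ H] [CompleteSpace H] (ρ : X → Op H),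
    IsCQState ρ → k ≤ condMinEntropy ρ →
      traceDist (seeded ρ (fun x s => (ext x s, next x s))) (uniformWith (Z × S) (marginal ρ))
        ≤ ENNReal.ofReal ε

/-- Re-use of the outgoing seed for another extraction. Two raw strings `X₁`, `X₂` with
`H_min(X₁|X₂E) ≥ k` and `H_min(X₂|E) ≥ k` are processed one after the other, the first one with a
uniform seed and the second one with the outgoing seed of the first round. Both outputs, the final
outgoing seed and `E` are jointly `ε`-close to uniform, uniform, uniform and `ρ_E`. -/
def IsSecureUnderSeedReuse.{u} {X S Z : Type} [Fintype X] [Fintype S] [Fintype Z]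
    [DecidableEq S] [DecidableEq Z] (ext : X → S → Z) (next : X → S → S) (k ε : ℝ) : Prop :=
  ∀ (H : Type u) [NormedAddCommGroup H] [InnerProductSpace ℂ H] [CompleteSpace H]
    (ρ : X × X → Op H),
    IsCQState ρ →
    k ≤ condMinEntropy (fun x₁ => cqOp (fun x₂ => ρ (x₁, x₂))) →
    k ≤ condMinEntropy (fun x₂ => ∑ x₁, ρ (x₁, x₂)) →
      traceDist
        (seeded ρ (fun x s =>
          (ext x.1 s, ext x.2 (next x.1 s), next x.2 (next x.1 s))))
        (uniformWith (Z × Z × S) (marginal ρ)) ≤ ENNReal.ofReal ε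

end

/-! ### The stream extractors -/

/-- Bit strings of length `n`, as vectors over `𝔽₂`; addition is bitwise exclusive-or. -/
abbrev Bits (n : ℕ) := Fin n → ZMod 2

/-- The first `m` bits. -/
def firstBits {N m : ℕ} (hm : m ≤ N) (v : Bits N) : Bits m :=
  fun i => v (Fin.castLE hm i)

/-- The last `N - m` bits. -/
def lastBits {N m : ℕ} (hm : m ≤ N) (v : Bits N) : Bits (N - m) :=
  fun i => v ⟨m + i, by have := i.2; omega⟩

/-- The stream extractor with a given mask: the first `m` bits of `x ⊕ w`, where `w` is the mask
computed from the seed `(r, y)`. -/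
def streamExt {N m d : ℕ} (hm : m ≤ N) (mask : Bits (N - m) → Bits d → Bits N)
    (x : Bits N) (s : Bits (N - m) × Bits d) : Bits m :=
  firstBits hm (x + mask s.1 s.2)

/-- The seed that the stream extractor hands on: the last `N - m` bits of `x ⊕ w` as the new `r`,
together with the same `y`. -/
def streamNextSeed {N m d : ℕ} (hm : m ≤ N) (mask : Bits (N - m) → Bits d → Bits N)
    (x : Bits N) (s : Bits (N - m) × Bits d) : Bits (N - m) × Bits d :=
  (lastBits hm (x + mask s.1 s.2), s.2)

/-- The string `r` followed by zeros, of total length `n`. -/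
def padZeros {l : ℕ} (n : ℕ) (r : Bits l) : Bits n :=
  fun i => if h : i.1 < l then r ⟨i.1, h⟩ else 0

/-- The circulant matrix with first row `v`; each row is the previous one shifted cyclically one
step to the right, so that the entry at `(i, j)` is `v (j - i mod n)`. -/
def circulantRows {n : ℕ} (v : Bits n) : Matrix (Fin n) (Fin n) (ZMod 2) :=
  Matrix.of fun i j => v (j - i)

/-- The circulant mask: the first `n - 1` bits of `C_{r'} y`, where `r'` is the
`(n - m - 1)`-bit string `r` followed by `m + 1` zeros. -/
def circulantMask (n m : ℕ) (r : Bits (n - 1 - m)) (y : Bits n) : Bits (n - 1) :=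
  firstBits (Nat.sub_le n 1) (circulantRows (padZeros n r) *ᵥ y)

/-- The `(n - m) × m` Toeplitz matrix with entry `y_{j - i}` at `(i, j)`, where
`y = (y_{1+m-n}, …, y_{m-1})` is stored as a vector of length `n - 1` indexed from `0`. -/
def toeplitzBlock (n m : ℕ) (y : Bits (n - 1)) : Matrix (Fin (n - m)) (Fin m) (ZMod 2) :=
  Matrix.of fun i j => y ⟨(j.1 + (n - m - 1)) - i.1, by have := i.2; have := j.2; omega⟩

/-- The modified Toeplitz mask `(M_y, I_{n-m})ᵀ r`. -/
def modifiedToeplitzMask (n m : ℕ) (hm : m ≤ n) (r : Bits (n - m)) (y : Bits (n - 1)) : Bits n :=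
  ((Matrix.fromCols (toeplitzBlock n m y) (1 : Matrix (Fin (n - m)) (Fin (n - m)) (ZMod 2)))ᵀ *ᵥ r)
    ∘ (finSumFinEquiv.trans (finCongr (Nat.add_sub_of_le hm))).symm

/-- `StreamC`, with raw data of `n - 1` bits and the seed `(r, y)` of `(n - m - 1) + n` bits. -/
def StreamC (n m : ℕ) (hm : m ≤ n - 1) :
    Bits (n - 1) → Bits (n - 1 - m) × Bits n → Bits m :=
  streamExt hm (circulantMask n m)

/-- The outgoing seed of `StreamC`. -/
def StreamCNextSeed (n m : ℕ) (hm : m ≤ n - 1) :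
    Bits (n - 1) → Bits (n - 1 - m) × Bits n → Bits (n - 1 - m) × Bits n :=
  streamNextSeed hm (circulantMask n m)

/-- `StreamM`, with raw data of `n` bits and the seed `(r, y)` of `(n - m) + (n - 1)` bits. -/
def StreamM (n m : ℕ) (hm : m ≤ n) :
    Bits n → Bits (n - m) × Bits (n - 1) → Bits m :=
  streamExt hm (modifiedToeplitzMask n m hm)

/-- The outgoing seed of `StreamM`. -/
def StreamMNextSeed (n m : ℕ) (hm : m ≤ n) :
    Bits n → Bits (n - m) × Bits (n - 1) → Bits (n - m) × Bits (n - 1) :=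
  streamNextSeed hm (modifiedToeplitzMask n m hm)

end StreamExtraction

open StreamExtraction

universe u

/-! Output and outgoing seed together are a bijective image of `(x + w r y, y)`. Strength in the
outgoing seed therefore says exactly that this pair is nearly uniform and independent of `E`; plain
extraction follows by discarding the seed.

For fixed `y` the mask is linear in `r`, so `x` is shifted by a uniform element of a linear code. On
the Walsh side this shift keeps the coefficients at the dual code and kills all others, and
subtracting the uniform state kills the one at `0` (`walsh_maskDeviation`). If every nonzero `a`
lies in the dual code for at most a fraction `2^(-(N-m))` of the `y` (`IsDualUniversal`), Parseval
bounds the deviation in any positive quadratic form (`sum_maskDeviation_le`). The form `Re Tr (S†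
σ⁻¹ T)` with `ρ x ≤ l σ`, and a Cauchy-Schwarz inequality weighted by `σ`, turn this into a trace
norm bound (`sum_norm_inner_le`, `weightedForm_le`). Everything is tested on finitely many vectors,
so an arbitrary `H` is first compressed to their span.

With `s = 2^((m-k)/2)` the ideal estimate is `‖Δ‖₁ ≤ s`, whereas `2 s` is allowed. Since `s²` is
proportional to `l` times the trace of `σ`, a factor 4 is free there: one factor 2 makes `σ`
invertible, the other pays for a supremum in the min-entropy that need not be attained.

Dual universality reduces to the nonvanishing of a bilinear expression in `a` and `r`. For Toeplitz
masks this follows from an extremal diagonal, for circulant masks from `𝔽₂[X]/Φ_n` being a field.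
Re-use of the seed is a two-step hybrid argument. -/

namespace StreamExtraction

/-! ### Characters and the Walsh-Hadamard transform -/

/-- The nontrivial real character of `𝔽₂`. -/
noncomputable def signChar : AddChar (ZMod 2) ℝ where
  toFun t := if t = 0 then 1 else -1
  map_zero_eq_one' := by simp
  map_add_eq_mul' := by
    have h : ∀ a : ZMod 2, a = 0 ∨ a = 1 := by decide
    have h2 : (1 + 1 : ZMod 2) = 0 := by decide
    intro a b
    rcases h a with rfl | rfl <;> rcases h b with rfl | rfl <;> simp [h2]

lemma signChar_eq_one_iff (t : ZMod 2) : signChar t = 1 ↔ t = 0 := by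
  change (if t = 0 then (1 : ℝ) else -1) = 1 ↔ t = 0
  split_ifs with h <;> simp [h]
  norm_num

lemma sum_signChar_comp {G : Type*} [AddGroup G] [Fintype G] (φ : G →+ ZMod 2)
    [Decidable (∀ g, φ g = 0)] :
    ∑ g, signChar (φ g) = if ∀ g, φ g = 0 then (Fintype.card G : ℝ) else 0 := by
  classical
  have h := AddChar.sum_eq_ite (signChar.compAddMonoidHom φ)
  have h0 : signChar.compAddMonoidHom φ = 0 ↔ ∀ g, φ g = 0 := by
    rw [DFunLike.ext_iff]
    exact forall_congr' fun g => by simp [signChar_eq_one_iff]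
  simp only [AddChar.compAddMonoidHom_apply, h0] at h
  convert h

/-- Pairing with a fixed bit string. -/
def dotHom {N : ℕ} (a : Bits N) : Bits N →+ ZMod 2 where
  toFun x := a ⬝ᵥ x
  map_zero' := dotProduct_zero a
  map_add' := dotProduct_add a

@[simp] lemma dotHom_apply {N : ℕ} (a x : Bits N) : dotHom a x = a ⬝ᵥ x := rfl

lemma forall_dotProduct_eq_zero_iff {N : ℕ} (a : Bits N) : (∀ x, a ⬝ᵥ x = 0) ↔ a = 0 :=
  ⟨fun h => dotProduct_eq_zero a h, fun h => by simp [h]⟩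

section Fourier

variable {V : Type*} [AddCommGroup V] [Module ℝ V] {N : ℕ}

/-- The Walsh-Hadamard transform of a vector-valued function on bit strings. -/
noncomputable def walsh (F : Bits N → V) (a : Bits N) : V := ∑ x, signChar (a ⬝ᵥ x) • F x

lemma sum_signChar_dot (a : Bits N) :
    ∑ x : Bits N, signChar (a ⬝ᵥ x) = if a = 0 then (2 : ℝ) ^ N else 0 := by
  classical
  have h := sum_signChar_comp (dotHom a)
  simp only [dotHom_apply, forall_dotProduct_eq_zero_iff] at h
  rw [h]; simp

/-- Orthogonality of characters only uses bilinearity, so no inner product on `V` is needed; later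
`V` is a space of operators. -/
lemma walsh_parseval (B : V →ₗ[ℝ] V →ₗ[ℝ] ℝ) (F : Bits N → V) :
    ∑ a, B (walsh F a) (walsh F a) = 2 ^ N * ∑ x, B (F x) (F x) := by
  have h1 : ∀ a, B (walsh F a) (walsh F a) =
      ∑ x, ∑ x', signChar ((x + x') ⬝ᵥ a) * B (F x) (F x') := by
    intro a
    simp only [walsh, map_sum, LinearMap.sum_apply, map_smul, LinearMap.smul_apply, smul_eq_mul,
      Finset.mul_sum]
    rw [Finset.sum_comm]
    refine Finset.sum_congr rfl fun x _ => Finset.sum_congr rfl fun x' _ => ?_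
    rw [add_dotProduct, AddChar.map_add_eq_mul, dotProduct_comm a, dotProduct_comm a]
    ring
  simp only [h1]
  rw [Finset.sum_comm, Finset.mul_sum]
  refine Finset.sum_congr rfl fun x _ => ?_
  rw [Finset.sum_comm]
  simp only [← Finset.sum_mul, sum_signChar_dot]
  rw [Finset.sum_eq_single x]
  · have h : x + x = 0 := funext fun i => CharTwo.add_self_eq_zero (x i)
    simp [h]
  · intro x' _ hx
    rw [if_neg, zero_mul]
    intro h
    exact hx (funext fun i => (CharTwo.add_eq_zero.1 (congrFun h i)).symm)
  · simp

end Fourier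

/-! ### Dual universal masks and leftover hashing in a quadratic form -/

/-- The masks `w · y`, for random `y`, form a family of linear codes whose duals contain each
nonzero string with probability at most that of a random code. -/
structure IsDualUniversal {N m : ℕ} {Y : Type*} [Fintype Y]
    (w : Bits (N - m) → Y → Bits N) : Prop where
  map_add : ∀ r r' y, w (r + r') y = w r y + w r' y
  card_le : ∀ a : Bits N, a ≠ 0 →
    Nat.card {y // ∀ r, a ⬝ᵥ w r y = 0} * 2 ^ (N - m) ≤ Fintype.card Y

/-- The deviation from uniformity of the masked string `x + w r y` together with `y`. -/
noncomputable def maskDeviation {V : Type*} [AddCommGroup V] [Module ℝ V] {N m : ℕ}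
    {Y : Type*} [Fintype Y] [DecidableEq Y]
    (w : Bits (N - m) → Y → Bits N) (F : Bits N → V) (p : Bits N × Y) : V :=
  (∑ x, ∑ s : Bits (N - m) × Y, if (x + w s.1 s.2, s.2) = p then
    (Fintype.card (Bits (N - m) × Y) : ℝ)⁻¹ • F x else 0) -
    (Fintype.card (Bits N × Y) : ℝ)⁻¹ • ∑ x, F x

/-- Masking is a convolution with the uniform distribution on a linear code, whose Walsh transform
is the indicator of the dual code. -/
lemma walsh_maskDeviation {V : Type*} [AddCommGroup V] [Module ℝ V] {N m : ℕ}
    {Y : Type*} [Fintype Y] [DecidableEq Y] {w : Bits (N - m) → Y → Bits N}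
    (hw : IsDualUniversal w) (F : Bits N → V) (a : Bits N) (y : Y)
    [Decidable (∀ r, a ⬝ᵥ w r y = 0)] :
    walsh (fun u => maskDeviation w F (u, y)) a =
      (if a ≠ 0 ∧ ∀ r, a ⬝ᵥ w r y = 0 then (Fintype.card Y : ℝ)⁻¹ else 0) • walsh F a := by
  classical
  have hY : (Fintype.card Y : ℝ) ≠ 0 := by
    have : Nonempty Y := ⟨y⟩
    exact_mod_cast Fintype.card_ne_zero
  have h1 : ∀ u, (∑ x, ∑ s : Bits (N - m) × Y, if (x + w s.1 s.2, s.2) = (u, y) then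
      (Fintype.card (Bits (N - m) × Y) : ℝ)⁻¹ • F x else 0) =
      ∑ x, ∑ r, if x + w r y = u then
        (Fintype.card (Bits (N - m) × Y) : ℝ)⁻¹ • F x else 0 := by
    intro u
    refine Finset.sum_congr rfl fun x _ => ?_
    rw [Fintype.sum_prod_type]
    refine Finset.sum_congr rfl fun r _ => ?_
    rw [Finset.sum_eq_single y]
    · simp
    · intro y' _ hy
      simp [hy]
    · simp
  have h2 : walsh (fun u => ∑ x, ∑ r, if x + w r y = u then
        (Fintype.card (Bits (N - m) × Y) : ℝ)⁻¹ • F x else 0) a =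
      ((Fintype.card (Bits (N - m) × Y) : ℝ)⁻¹ * ∑ r, signChar (a ⬝ᵥ w r y)) • walsh F a := by
    simp only [walsh, Finset.smul_sum, smul_ite, smul_zero]
    rw [Finset.sum_comm]
    refine Finset.sum_congr rfl fun x _ => ?_
    rw [Finset.sum_comm]
    simp only [Finset.sum_ite_eq, Finset.mem_univ, if_true, dotProduct_add,
      AddChar.map_add_eq_mul, smul_smul]
    rw [← Finset.sum_smul, Finset.mul_sum, Finset.sum_mul]
    congr 1
    refine Finset.sum_congr rfl fun r _ => ?_
    ring
  have h3 : ∑ r, signChar (a ⬝ᵥ w r y) =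
      if ∀ r, a ⬝ᵥ w r y = 0 then (Fintype.card (Bits (N - m)) : ℝ) else 0 := by
    have h := sum_signChar_comp (AddMonoidHom.mk' (fun r => a ⬝ᵥ w r y)
      (fun r r' => by rw [hw.map_add, dotProduct_add]))
    simpa using h
  have h4 : walsh (fun u => maskDeviation w F (u, y)) a =
      walsh (fun u => ∑ x, ∑ r, if x + w r y = u then
        (Fintype.card (Bits (N - m) × Y) : ℝ)⁻¹ • F x else 0) a -
      (∑ u : Bits N, signChar (a ⬝ᵥ u)) • (Fintype.card (Bits N × Y) : ℝ)⁻¹ • ∑ x, F x := by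
    simp only [walsh, maskDeviation, h1, smul_sub, Finset.sum_sub_distrib, Finset.sum_smul]
  rw [h4, h2, h3, sum_signChar_dot]
  -- The coefficient at `0` is the total mass, which masked and uniform states share for every `y`.
  by_cases ha : a = 0
  · subst ha
    simp only [zero_dotProduct, implies_true, if_true, ne_eq, not_true_eq_false, false_and,
      if_false, zero_smul, walsh, AddChar.map_zero_eq_one, one_smul, Fintype.card_prod,
      Nat.cast_mul, smul_smul]
    rw [← sub_smul]
    convert zero_smul ℝ _
    have hR : (Fintype.card (Bits (N - m)) : ℝ) ≠ 0 := by exact_mod_cast Fintype.card_ne_zero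
    have hN : (Fintype.card (Bits N) : ℝ) = 2 ^ N := by simp
    rw [hN]
    field_simp
    simp
  · simp only [ha, ne_eq, not_false_eq_true, true_and, if_false, zero_smul, sub_zero]
    congr 1
    split_ifs with h
    · have hR : (Fintype.card (Bits (N - m)) : ℝ) ≠ 0 := by exact_mod_cast Fintype.card_ne_zero
      rw [Fintype.card_prod, Nat.cast_mul]
      field_simp
    · simp

/-- Leftover hashing for dual universal masks, for an arbitrary positive form. -/
theorem sum_maskDeviation_le {V : Type*} [AddCommGroup V] [Module ℝ V] {N m : ℕ} (hm : m ≤ N)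
    {Y : Type*} [Fintype Y] [DecidableEq Y] {w : Bits (N - m) → Y → Bits N}
    (hw : IsDualUniversal w) (B : V →ₗ[ℝ] V →ₗ[ℝ] ℝ) (hB : ∀ v, 0 ≤ B v v) (F : Bits N → V) :
    ∑ p, B (maskDeviation w F p) (maskDeviation w F p) ≤
      2 ^ m / Fintype.card (Bits N × Y) * ∑ x, B (F x) (F x) := by
  classical
  rcases isEmpty_or_nonempty Y with hY | hY
  · simp
  have hM : (0 : ℝ) < Fintype.card Y := by exact_mod_cast Fintype.card_pos
  set M : ℝ := (Fintype.card Y : ℝ)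
  have h1 : ∀ y, ∑ u, B (maskDeviation w F (u, y)) (maskDeviation w F (u, y)) =
      (2 ^ N)⁻¹ * ∑ a, (if a ≠ 0 ∧ ∀ r, a ⬝ᵥ w r y = 0 then M⁻¹ ^ 2 else 0) *
        B (walsh F a) (walsh F a) := by
    intro y
    have h := walsh_parseval B (fun u => maskDeviation w F (u, y))
    simp only [walsh_maskDeviation hw, map_smul, LinearMap.smul_apply, smul_eq_mul] at h
    rw [eq_inv_mul_iff_mul_eq₀ (by positivity), ← h]
    refine Finset.sum_congr rfl fun a _ => ?_
    split_ifs <;> (simp [M]; try ring)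
  rw [Fintype.sum_prod_type, Finset.sum_comm]
  simp only [h1]
  rw [← Finset.mul_sum, Finset.sum_comm]
  have h2 : ∀ a : Bits N, ∑ y, (if a ≠ 0 ∧ ∀ r, a ⬝ᵥ w r y = 0 then M⁻¹ ^ 2 else 0) *
      B (walsh F a) (walsh F a) ≤ M⁻¹ * (2 ^ (N - m))⁻¹ * B (walsh F a) (walsh F a) := by
    intro a
    rw [← Finset.sum_mul]
    refine mul_le_mul_of_nonneg_right ?_ (hB _)
    by_cases ha : a = 0
    · simp only [ha, ne_eq, not_true_eq_false, false_and, if_false, Finset.sum_const_zero]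
      positivity
    · have hc := hw.card_le a ha
      simp only [ha, ne_eq, not_false_eq_true, true_and]
      rw [← Finset.sum_filter, Finset.sum_const, nsmul_eq_mul]
      rw [Nat.card_eq_fintype_card, Fintype.card_subtype] at hc
      have hc' : ((Finset.univ.filter fun y => ∀ r, a ⬝ᵥ w r y = 0).card : ℝ) * 2 ^ (N - m) ≤ M := by
        simp only [M]
        exact_mod_cast hc
      rw [← le_div_iff₀ (by positivity)] at hc'
      calc _ ≤ M / 2 ^ (N - m) * M⁻¹ ^ 2 := by gcongr
        _ = _ := by field_simp
  calc _ ≤ ((2 : ℝ) ^ N)⁻¹ * ∑ a, M⁻¹ * (2 ^ (N - m))⁻¹ * B (walsh F a) (walsh F a) := by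
        gcongr with a
        exact h2 a
    _ = _ := by
        rw [← Finset.mul_sum, walsh_parseval]
        have hN : (Fintype.card (Bits N) : ℝ) = 2 ^ (N - m) * 2 ^ m := by
          rw [← pow_add, Nat.sub_add_cancel hm]; simp
        rw [Fintype.card_prod, Nat.cast_mul, hN]
        simp only [M]
        field_simp

/-! ### Bessel families and the weighted trace form -/

section Bessel

variable {H : Type*} [NormedAddCommGroup H] [InnerProductSpace ℂ H]

/-- A finite family of vectors that satisfies Bessel's inequality. -/
def IsBessel {ι : Type*} [Fintype ι] (e : ι → H) : Prop :=
  ∀ v, ∑ i, ‖inner ℂ (e i) v‖ ^ 2 ≤ ‖v‖ ^ 2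

lemma _root_.Orthonormal.isBessel {ι : Type*} [Fintype ι] {e : ι → H} (he : Orthonormal ℂ e) :
    IsBessel e :=
  fun v => he.sum_inner_products_le v

lemma inner_mul_inner_self (v g : H) :
    inner ℂ g v * inner ℂ v g = ((‖inner ℂ v g‖ ^ 2 : ℝ) : ℂ) := by
  rw [← inner_conj_symm g v, Complex.conj_mul']
  norm_cast

/-- The form `(S, T) ↦ Re Tr (S† τ T)`. -/
noncomputable def weightedForm {J : Type*} [Fintype J] (b : J → H) (τ : H →ₗ[ℂ] H) :
    (H →ₗ[ℂ] H) →ₗ[ℝ] (H →ₗ[ℂ] H) →ₗ[ℝ] ℝ :=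
  LinearMap.mk₂ ℝ (fun S T => ∑ j, (inner ℂ (S (b j)) (τ (T (b j)))).re)
    (fun S S' T => by simp [Finset.sum_add_distrib])
    (fun c S T => by
      simp [Finset.mul_sum, inner_smul_left_eq_smul, LinearMap.smul_apply])
    (fun S T T' => by simp [Finset.sum_add_distrib])
    (fun c S T => by
      simp [Finset.mul_sum, LinearMap.smul_apply, ← Complex.coe_smul])

lemma weightedForm_apply {J : Type*} [Fintype J] (b : J → H) (τ S T : H →ₗ[ℂ] H) :
    weightedForm b τ S T = ∑ j, (inner ℂ (S (b j)) (τ (T (b j)))).re := rfl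

end Bessel

/-! ### Trace inequalities in finite dimension -/

section FiniteDimensional

variable {K : Type*} [NormedAddCommGroup K] [InnerProductSpace ℂ K] [FiniteDimensional ℂ K]

lemma exists_inner_eq_sum_of_isPositive {T : K →ₗ[ℂ] K} (hT : T.IsPositive) :
    ∃ (n : ℕ) (v : Fin n → K), ∀ f g, inner ℂ f (T g) = ∑ k, inner ℂ f (v k) * inner ℂ (v k) g := by
  have h := (LinearMap.isPositive_toContinuousLinearMap_iff T).2 hT
  obtain ⟨n, v, hv⟩ := ContinuousLinearMap.isPositive_iff_eq_sum_rankOne.1 h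
  refine ⟨n, v, fun f g => ?_⟩
  have : T g = ∑ k, inner ℂ (v k) g • v k := by
    have := congrArg (fun S : K →L[ℂ] K => S g) hv
    simpa [sum_apply] using this
  rw [this, inner_sum]
  exact Finset.sum_congr rfl fun k _ => by rw [inner_smul_right, mul_comm]

/-- Weighted Cauchy-Schwarz inequality for a positive operator. -/
lemma two_mul_norm_inner_le {T : K →ₗ[ℂ] K} (hT : T.IsPositive) {t : ℝ} (ht : 0 < t) (f g : K) :
    2 * ‖inner ℂ f (T g)‖ ≤ t * (inner ℂ f (T f)).re + t⁻¹ * (inner ℂ g (T g)).re := by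
  obtain ⟨n, v, hv⟩ := exists_inner_eq_sum_of_isPositive hT
  simp only [hv, inner_mul_inner_self, ← Complex.ofReal_sum, Complex.ofReal_re]
  rw [Finset.mul_sum, Finset.mul_sum, ← Finset.sum_add_distrib]
  refine (mul_le_mul_of_nonneg_left (norm_sum_le _ _) zero_le_two).trans ?_
  rw [Finset.mul_sum]
  refine Finset.sum_le_sum fun k _ => ?_
  rw [norm_mul, norm_inner_symm f]
  set a := ‖inner ℂ (v k) f‖
  set b := ‖inner ℂ (v k) g‖
  have : 0 ≤ t⁻¹ * (t * a - b) ^ 2 := by positivity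
  calc _ = t * a ^ 2 + t⁻¹ * b ^ 2 - t⁻¹ * (t * a - b) ^ 2 := by field_simp; ring
    _ ≤ _ := by linarith

/-- For a rank-one operator this is Bessel's inequality against Parseval's identity; a positive
operator is a sum of such. -/
lemma IsBessel.sum_inner_le {ι J : Type*} [Fintype ι] [Fintype J] {e : ι → K} (he : IsBessel e)
    (b : OrthonormalBasis J ℂ K) {T : K →ₗ[ℂ] K} (hT : T.IsPositive) :
    ∑ i, (inner ℂ (e i) (T (e i))).re ≤ ∑ j, (inner ℂ (b j) (T (b j))).re := by
  obtain ⟨n, v, hv⟩ := exists_inner_eq_sum_of_isPositive hT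
  simp only [hv, inner_mul_inner_self, ← Complex.ofReal_sum, Complex.ofReal_re]
  rw [Finset.sum_comm, Finset.sum_comm (γ := J)]
  refine Finset.sum_le_sum fun k _ => ?_
  rw [b.sum_sq_norm_inner_left]
  simpa only [norm_inner_symm] using he (v k)

/-- A Cauchy-Schwarz bound for the trace norm of a block diagonal operator. -/
theorem sum_norm_inner_le {A ι J : Type*} [Fintype A] [Fintype ι] [Fintype J]
    (b : OrthonormalBasis J ℂ K) {σ τ : K →ₗ[ℂ] K} (hσ : σ.IsPositive) (hτ : τ.IsPositive)
    (hστ : ∀ v, σ (τ v) = v) (Δ : A → K →ₗ[ℂ] K) {e f : A → ι → K}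
    (he : ∀ a, IsBessel (e a)) (hf : ∀ a, IsBessel (f a)) {t : ℝ} (ht : 0 < t) :
    2 * ∑ a, ∑ i, ‖inner ℂ (f a i) (Δ a (e a i))‖ ≤
      t * (Fintype.card A * ∑ j, (inner ℂ (b j) (σ (b j))).re) +
        t⁻¹ * ∑ a, weightedForm b τ (Δ a) (Δ a) := by
  have h1 : ∀ a i, 2 * ‖inner ℂ (f a i) (Δ a (e a i))‖ ≤
      t * (inner ℂ (f a i) (σ (f a i))).re +
        t⁻¹ * (inner ℂ (e a i) ((LinearMap.adjoint (Δ a) ∘ₗ τ ∘ₗ Δ a) (e a i))).re := by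
    intro a i
    -- Writing `Δ = σ τ Δ` splits the weight: `f` is measured by `σ`, and `e` by `Δ† τ σ τ Δ = Δ† τ
    -- Δ`.
    have h := two_mul_norm_inner_le hσ ht (f a i) (τ (Δ a (e a i)))
    rw [hστ, hτ.isSymmetric] at h
    simpa [LinearMap.adjoint_inner_right] using h
  have h2 : ∀ a, ∑ i, 2 * ‖inner ℂ (f a i) (Δ a (e a i))‖ ≤
      t * ∑ j, (inner ℂ (b j) (σ (b j))).re + t⁻¹ * weightedForm b τ (Δ a) (Δ a) := by
    intro a
    refine (Finset.sum_le_sum fun i _ => h1 a i).trans ?_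
    rw [Finset.sum_add_distrib, ← Finset.mul_sum, ← Finset.mul_sum]
    refine add_le_add ?_ ?_
    · exact mul_le_mul_of_nonneg_left ((hf a).sum_inner_le b hσ) ht.le
    · refine mul_le_mul_of_nonneg_left
        (((he a).sum_inner_le b (hτ.adjoint_conj (Δ a))).trans_eq ?_) (by positivity)
      simp [weightedForm_apply, LinearMap.adjoint_inner_right]
  simp only [Finset.mul_sum] at *
  refine (Finset.sum_le_sum fun a _ => h2 a).trans_eq ?_
  simp only [Finset.sum_add_distrib, Finset.sum_const, Finset.card_univ, nsmul_eq_mul]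
  congr 1
  simp only [Finset.mul_sum]
  exact Finset.sum_congr rfl fun j _ => by ring

/-- If `0 ≤ ρ ≤ l σ` then `ρ σ⁻¹ ρ ≤ l ρ`. -/
lemma weightedForm_le {J : Type*} [Fintype J] (b : J → K) {σ τ ρ : K →ₗ[ℂ] K}
    (hρ : ρ.IsPositive) (hστ : ∀ v, σ (τ v) = v) {l : ℝ} (hl : 0 < l)
    (h : ∀ v, (inner ℂ v (ρ v)).re ≤ l * (inner ℂ v (σ v)).re) :
    weightedForm b τ ρ ρ ≤ l * ∑ j, (inner ℂ (b j) (ρ (b j))).re := by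
  rw [weightedForm_apply, Finset.mul_sum]
  refine Finset.sum_le_sum fun j _ => ?_
  set v := b j
  set w := τ (ρ v)
  have hw : σ w = ρ v := hστ _
  -- With `w = σ⁻¹ ρ v`, the term `l⁻¹ ⟪w, ρ w⟫` is at most `⟪w, σ w⟫ = ⟪w, ρ v⟫`, half of the left
  -- side, and can be absorbed.
  have h1 := two_mul_norm_inner_le hρ hl v w
  have h2 := h w
  rw [hw] at h2
  have h3 : (inner ℂ (ρ v) w).re = (inner ℂ v (ρ w)).re := by rw [hρ.isSymmetric]
  have h4 : (inner ℂ w (ρ v)).re = (inner ℂ (ρ v) w).re := inner_re_symm (𝕜 := ℂ) _ _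
  have h5 := Complex.re_le_norm (inner ℂ v (ρ w))
  have h6 : l⁻¹ * (inner ℂ w (ρ w)).re ≤ (inner ℂ (ρ v) w).re := by
    rw [inv_mul_le_iff₀ hl, ← h4]; exact h2
  linarith

/-- A positive operator of trace at most one on a finite-dimensional space is dominated by an
invertible one of trace at most two. -/
lemma exists_invertible_dominating {J : Type*} [Fintype J] (b : OrthonormalBasis J ℂ K)
    {σ : K →ₗ[ℂ] K} (hσ : σ.IsPositive) (htr : ∑ j, (inner ℂ (b j) (σ (b j))).re ≤ 1) :
    ∃ σ' τ : K →ₗ[ℂ] K, σ'.IsPositive ∧ τ.IsPositive ∧ (∀ v, σ' (τ v) = v) ∧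
      (∀ v, (inner ℂ v (σ v)).re ≤ (inner ℂ v (σ' v)).re) ∧
      ∑ j, (inner ℂ (b j) (σ' (b j))).re ≤ 2 := by
  -- Adding `c` times the identity raises the trace by `dim / (dim + 1) ≤ 1`, also in dimension `0`.
  set c : ℝ := ((Fintype.card J : ℝ) + 1)⁻¹ with hc
  have hc0 : 0 < c := by positivity
  set σ' : K →ₗ[ℂ] K := σ + (c : ℂ) • LinearMap.id with hσ'
  have hpos : σ'.IsPositive :=
    hσ.add (LinearMap.isPositive_id.smul_of_nonneg (by exact_mod_cast hc0.le))
  have happ : ∀ v, (inner ℂ v (σ' v)).re = (inner ℂ v (σ v)).re + c * ‖v‖ ^ 2 := by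
    intro v
    simp only [hσ', LinearMap.add_apply, LinearMap.smul_apply, LinearMap.id_apply, inner_add_right,
      inner_smul_right, Complex.add_re, Complex.re_ofReal_mul]
    rw [inner_self_eq_norm_sq_to_K]
    norm_cast
  have hinj : Function.Injective σ' := by
    rw [← LinearMap.ker_eq_bot, LinearMap.ker_eq_bot']
    intro v hv
    have h1 := happ v
    rw [hv, inner_zero_right] at h1
    have h2 : 0 ≤ (inner ℂ v (σ v)).re := hσ.re_inner_nonneg_right v
    have h3 : c * ‖v‖ ^ 2 ≤ 0 := by simp at h1; linarith
    have h4 : ‖v‖ ^ 2 ≤ 0 := by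
      by_contra! h
      exact absurd h3 (not_le.2 (mul_pos hc0 h))
    simpa using le_antisymm h4 (by positivity)
  let E : K ≃ₗ[ℂ] K := LinearEquiv.ofInjectiveEndo σ' hinj
  have hE : ∀ v, σ' (E.symm v) = v := fun v => E.apply_symm_apply v
  refine ⟨σ', E.symm.toLinearMap, hpos, ?_, hE, fun v => ?_, ?_⟩
  · refine ⟨fun v w => ?_, fun v => ?_⟩
    · have := hpos.isSymmetric (E.symm v) (E.symm w)
      rw [hE, hE] at this
      exact this.symm
    · have := hpos.re_inner_nonneg_right (E.symm v)
      rw [hE] at this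
      exact this
  · rw [happ]
    have : 0 ≤ c * ‖v‖ ^ 2 := by positivity
    linarith
  · simp only [happ, b.norm_eq_one, Finset.sum_add_distrib]
    have : ∑ _j : J, c * 1 ^ 2 ≤ 1 := by
      simp only [one_pow, mul_one, Finset.sum_const, Finset.card_univ, nsmul_eq_mul, hc]
      rw [← div_eq_mul_inv, div_le_one (by positivity)]
      linarith
    linarith

end FiniteDimensional

variable {H : Type*} [NormedAddCommGroup H] [InnerProductSpace ℂ H]

/-! ### Block diagonal operators -/

section ClassicalQuantum

variable {X : Type*} [Fintype X]

@[simp] lemma cqOp_apply (T : X → Op H) (v : Joint X H) (x : X) : cqOp T v x = T x (v x) := rfl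

lemma inner_cqOp (T : X → Op H) (v w : Joint X H) :
    inner ℂ v (cqOp T w) = ∑ x, inner ℂ (v x) (T x (w x)) := by
  simp [PiLp.inner_apply]

lemma cqOp_sub (S T : X → Op H) : cqOp S - cqOp T = cqOp (fun x => S x - T x) := by
  ext v x; simp

lemma cqOp_smul (c : ℂ) (T : X → Op H) : c • cqOp T = cqOp (fun x => c • T x) := by
  ext v x; simp

lemma inner_single_left [DecidableEq X] (x : X) (v : H) (w : Joint X H) :
    inner ℂ (PiLp.single 2 x v : Joint X H) w = inner ℂ v (w x) := by
  rw [PiLp.inner_apply, Finset.sum_eq_single x]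
  · simp
  · intro y _ hy
    simp [hy]
  · simp

lemma isPositive_cqOp_iff {T : X → Op H} : (cqOp T).IsPositive ↔ ∀ x, (T x).IsPositive := by
  classical
  constructor
  · intro h x
    have key : ∀ v w : H, inner ℂ v (T x w) =
        inner ℂ (PiLp.single 2 x v : Joint X H) (cqOp T (PiLp.single 2 x w)) := by
      intro v w
      rw [inner_single_left]; simp
    refine ⟨fun v w => ?_, fun v => ?_⟩
    · change inner ℂ (T x v) w = inner ℂ v (T x w)
      rw [← inner_conj_symm, key, key, inner_conj_symm]
      exact h.isSymmetric _ _
    · rw [ContinuousLinearMap.reApplyInnerSelf_apply, inner_re_symm, key]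
      exact h.re_inner_nonneg_right _
  · intro h
    refine ⟨fun v w => ?_, fun v => ?_⟩
    · simp only [PiLp.inner_apply, ContinuousLinearMap.coe_coe, cqOp_apply]
      exact Finset.sum_congr rfl fun x _ => (h x).isSymmetric _ _
    · rw [ContinuousLinearMap.reApplyInnerSelf_apply, inner_re_symm, inner_cqOp, map_sum]
      exact Finset.sum_nonneg fun x _ => (h x).re_inner_nonneg_right _

lemma cqOp_le_smul_cqOp_iff {T : X → Op H} {σ : Op H} {c : ℂ} :
    cqOp T ≤ c • cqOp (fun _ => σ) ↔ ∀ x, T x ≤ c • σ := by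
  simp only [ContinuousLinearMap.le_def, cqOp_smul, cqOp_sub, isPositive_cqOp_iff]

end ClassicalQuantum

/-! ### Subnormalised states and min-entropy -/

section Trace

lemma sum_norm_inner_le_of_traceNorm_le {T : Op H} {c : ℝ} (hc : 0 ≤ c)
    (hT : traceNorm T ≤ ENNReal.ofReal c) {ι : Type*} [Fintype ι] {e f : ι → H}
    (he : Orthonormal ℂ e) (hf : Orthonormal ℂ f) : ∑ i, ‖inner ℂ (f i) (T (e i))‖ ≤ c := by
  let E := (Fintype.equivFin ι).symm
  have h : ∑ i, ‖inner ℂ (f (E i)) (T (e (E i)))‖ₑ ≤ traceNorm T :=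
    le_iSup_of_le (Fintype.card ι) <| le_iSup_of_le (e ∘ E) <| le_iSup_of_le (f ∘ E) <|
      le_iSup_of_le (he.comp E E.injective) <| le_iSup_of_le (hf.comp E E.injective) le_rfl
  rw [E.sum_comp (fun i => ‖inner ℂ (f i) (T (e i))‖ₑ)] at h
  have h2 := h.trans hT
  simp only [← ofReal_norm] at h2
  rwa [← ENNReal.ofReal_sum_of_nonneg fun _ _ => norm_nonneg _, ENNReal.ofReal_le_ofReal_iff hc]
    at h2

/-- A positive operator of trace at most one. -/
structure IsSubDensity (σ : Op H) : Prop where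
  isPositive : σ.IsPositive
  trace_le : ∀ {ι : Type} [Fintype ι] {b : ι → H}, Orthonormal ℂ b →
    ∑ i, (inner ℂ (b i) (σ (b i))).re ≤ 1

/-- A family of positive operators of total trace at most one. -/
structure IsSubState {X : Type*} [Fintype X] (ρ : X → Op H) : Prop where
  isPositive : ∀ x, (ρ x).IsPositive
  trace_le : ∀ {ι : Type} [Fintype ι] {b : ι → H}, Orthonormal ℂ b →
    ∑ x, ∑ i, (inner ℂ (b i) (ρ x (b i))).re ≤ 1

lemma IsDensity.isSubDensity {σ : Op H} (hσ : IsDensity σ) : IsSubDensity σ where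
  isPositive := hσ.1
  trace_le hb := (Finset.sum_le_sum fun _ _ => Complex.re_le_norm _).trans
    (sum_norm_inner_le_of_traceNorm_le zero_le_one (by simp [hσ.2]) hb hb)

lemma IsCQState.sum_le {X : Type*} [Fintype X] {ρ : X → Op H} (hρ : IsCQState ρ) {ι : Type*}
    [Fintype ι] {e : ι → Joint X H} (he : Orthonormal ℂ e) :
    ∑ i, ∑ x, (inner ℂ (e i x) (ρ x (e i x))).re ≤ 1 := by
  refine le_trans (Finset.sum_le_sum fun i _ => ?_)
    (sum_norm_inner_le_of_traceNorm_le (T := cqOp ρ) zero_le_one (by simp [hρ.2]) he he)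
  rw [inner_cqOp, ← Complex.re_sum]
  exact Complex.re_le_norm _

lemma IsCQState.isSubState {X : Type*} [Fintype X] {ρ : X → Op H} (hρ : IsCQState ρ) :
    IsSubState ρ where
  isPositive := isPositive_cqOp_iff.1 hρ.1
  trace_le {ι} _ b hb := by
    classical
    have he : Orthonormal ℂ fun p : X × ι => (PiLp.single 2 p.1 (b p.2) : Joint X H) := by
      rw [orthonormal_iff_ite] at hb ⊢
      rintro ⟨x, i⟩ ⟨y, j⟩
      rw [inner_single_left]
      by_cases h : x = y
      · subst h; simp [hb]
      · simp [h]
    have h := hρ.sum_le he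
    rw [Fintype.sum_prod_type] at h
    convert h using 4 with x _ i _
    rw [Finset.sum_eq_single x]
    · simp
    · intro y _ hy
      simp [hy]
    · simp

/-- Moves the register `Y` into the side information, as needed for `H_min(X₁|X₂E)`. -/
lemma IsCQState.isSubState_curry {X Y : Type*} [Fintype X] [Fintype Y] {ρ : X × Y → Op H}
    (hρ : IsCQState ρ) : IsSubState (fun x => cqOp fun y => ρ (x, y)) where
  isPositive x := isPositive_cqOp_iff.2 fun y => isPositive_cqOp_iff.1 hρ.1 (x, y)
  trace_le {ι} _ b hb := by
    classical
    let e : X × ι → Joint (X × Y) H :=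
      fun p => WithLp.toLp 2 fun q => if q.1 = p.1 then b p.2 q.2 else 0
    have hi : ∀ (p : X × ι) (w : Joint (X × Y) H),
        inner ℂ (e p) w = ∑ y, inner ℂ (b p.2 y) (w (p.1, y)) := by
      intro p w
      rw [PiLp.inner_apply, Fintype.sum_prod_type, Finset.sum_eq_single p.1]
      · simp [e]
      · intro x _ hx
        simp [e, hx]
      · simp
    have he : Orthonormal ℂ e := by
      rw [orthonormal_iff_ite] at hb ⊢
      rintro ⟨x, i⟩ ⟨x', j⟩
      rw [hi]
      by_cases h : x = x'
      · subst h
        have := hb i j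
        rw [PiLp.inner_apply] at this
        simp [e, this]
      · simp [e, h]
    have h := hρ.sum_le he
    rw [Fintype.sum_prod_type] at h
    convert h using 4 with x _ i _
    rw [inner_cqOp, Complex.re_sum, Fintype.sum_prod_type, Finset.sum_eq_single x]
    · simp [e]
    · intro x' _ hx
      simp [e, hx]
    · simp

lemma IsSubState.sum_fst {X Y : Type*} [Fintype X] [Fintype Y] {ρ : X × Y → Op H}
    (hρ : IsSubState ρ) : IsSubState (fun y => ∑ x, ρ (x, y)) where
  isPositive y := ContinuousLinearMap.isPositive_sum _ fun x _ => hρ.isPositive (x, y)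
  trace_le hb := by
    refine le_trans (le_of_eq ?_) (hρ.trace_le hb)
    simp only [sum_apply, inner_sum, Complex.re_sum]
    rw [Fintype.sum_prod_type_right]
    exact Finset.sum_congr rfl fun y _ => Finset.sum_comm

lemma IsSubState.isSubDensity_marginal {X : Type*} [Fintype X] {ρ : X → Op H}
    (hρ : IsSubState ρ) : IsSubDensity (marginal ρ) where
  isPositive := ContinuousLinearMap.isPositive_sum _ fun x _ => hρ.isPositive x
  trace_le hb := by
    refine le_trans (le_of_eq ?_) (hρ.trace_le hb)
    simp only [marginal, sum_apply, inner_sum, Complex.re_sum]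
    exact Finset.sum_comm

lemma IsSubState.le_marginal {X : Type*} [Fintype X] {ρ : X → Op H} (hρ : IsSubState ρ) (x : X) :
    ρ x ≤ marginal ρ := by
  classical
  rw [ContinuousLinearMap.le_def, marginal, ← Finset.add_sum_erase _ _ (Finset.mem_univ x),
    add_sub_cancel_left]
  exact ContinuousLinearMap.isPositive_sum _ fun y _ => hρ.isPositive y

/-- A lower bound on the min-entropy yields an operator inequality, up to one bit. -/
lemma IsSubState.exists_le_smul {X : Type*} [Fintype X] {ρ : X → Op H} (hρ : IsSubState ρ)
    {k : ℝ} (hk : k ≤ condMinEntropy ρ) :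
    ∃ (σ : Op H) (l : ℝ), IsSubDensity σ ∧ k - 1 < l ∧
      ∀ x, ρ x ≤ (((2 : ℝ) ^ (-l) : ℝ) : ℂ) • σ := by
  set L : Set ℝ := {l : ℝ | ∃ σ : Op H, IsDensity σ ∧
    cqOp ρ ≤ (((2 : ℝ) ^ (-l) : ℝ) : ℂ) • cqOp (fun _ : X => σ)} with hL
  have hk' : k ≤ sSup L := hk
  -- The real `sSup` is `0` on empty sets, so there `k ≤ 0` and `ρ x ≤ ρ_E` suffices. For unbounded
  -- `L` every exponent can be exceeded. In the bounded case the lost bit makes up for a supremum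
  -- that need not be attained.
  rcases L.eq_empty_or_nonempty with h | h
  · rw [h, Real.sSup_empty] at hk'
    exact ⟨marginal ρ, 0, hρ.isSubDensity_marginal, by linarith,
      fun x => by simpa using hρ.le_marginal x⟩
  · obtain ⟨l, ⟨σ, hσ, hle⟩, hl⟩ : ∃ l ∈ L, k - 1 < l := by
      by_cases hb : BddAbove L
      · exact exists_lt_of_lt_csSup h (by linarith)
      · exact not_bddAbove_iff.1 hb _
    exact ⟨σ, l, hσ.isSubDensity, hl, cqOp_le_smul_cqOp_iff.1 hle⟩

end Trace

/-! ### Trace norm bounds under operations on the classical register -/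

section TraceBound

/-- The sum of the trace norms of the operators `Δ a` is at most `c`, in a variational form with
Bessel families. -/
structure TraceBound {A : Type*} [Fintype A] (Δ : A → Op H) (c : ℝ) : Prop where
  sum_le : ∀ {ι : Type} [Fintype ι] {e f : A → ι → H}, (∀ a, IsBessel (e a)) → (∀ a, IsBessel (f a)) →
    ∑ a, ∑ i, ‖inner ℂ (f a i) (Δ a (e a i))‖ ≤ c

variable {A O : Type*} [Fintype A] [Fintype O]

/-- The blocks of an orthonormal system of the direct sum are in general not orthonormal, but they
satisfy Bessel's inequality; this is why test families are only required to be Bessel. -/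
lemma TraceBound.traceNorm_le {Δ : A → Op H} {c : ℝ} (h : TraceBound Δ c) :
    traceNorm (cqOp Δ) ≤ ENNReal.ofReal c := by
  classical
  refine iSup_le fun l => iSup_le fun e => iSup_le fun f => iSup_le fun he => iSup_le fun hf => ?_
  have hB : ∀ {e : Fin l → Joint A H}, Orthonormal ℂ e → ∀ a, IsBessel fun i => e i a := by
    intro e he a v
    have h := he.isBessel (PiLp.single 2 a v)
    rw [PiLp.norm_single] at h
    refine le_trans (Finset.sum_le_sum fun i _ => ?_) h
    rw [norm_inner_symm (e i), inner_single_left, norm_inner_symm]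
  have h2 := h.sum_le (hB he) (hB hf)
  rw [Finset.sum_comm] at h2
  simp only [← ofReal_norm]
  rw [← ENNReal.ofReal_sum_of_nonneg fun _ _ => norm_nonneg _]
  refine ENNReal.ofReal_le_ofReal (le_trans (Finset.sum_le_sum fun i _ => ?_) h2)
  rw [inner_cqOp]
  exact norm_sum_le _ _

lemma TraceBound.add {Δ Δ' : A → Op H} {c c' : ℝ} (h : TraceBound Δ c) (h' : TraceBound Δ' c') :
    TraceBound (fun a => Δ a + Δ' a) (c + c') := by
  refine ⟨fun {ι} _ {e f} he hf => ?_⟩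
  refine le_trans ?_ (add_le_add (h.sum_le he hf) (h'.sum_le he hf))
  simp only [← Finset.sum_add_distrib, add_apply, inner_add_right]
  exact Finset.sum_le_sum fun a _ => Finset.sum_le_sum fun i _ => norm_add_le _ _

/-- The image of a family of operators under a function of the classical register. -/
def pushforward [DecidableEq O] (g : A → O) (Δ : A → Op H) : O → Op H :=
  fun o => ∑ a, if g a = o then Δ a else 0

/-- Data processing: test families for the image pull back along `g`, and nothing forbids equal
families at different `a`. -/
lemma TraceBound.pushforward [DecidableEq O] {Δ : A → Op H} {c : ℝ} (h : TraceBound Δ c)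
    (g : A → O) : TraceBound (pushforward g Δ) c := by
  refine ⟨fun {ι} _ {e f} he hf => ?_⟩
  refine le_trans ?_ (h.sum_le (fun a => he (g a)) (fun a => hf (g a)))
  calc _ ≤ ∑ o, ∑ i, ∑ a, if g a = o then ‖inner ℂ (f o i) (Δ a (e o i))‖ else 0 := by
        refine Finset.sum_le_sum fun o _ => Finset.sum_le_sum fun i _ => ?_
        simp only [StreamExtraction.pushforward, sum_apply, inner_sum]
        refine (norm_sum_le _ _).trans_eq (Finset.sum_congr rfl fun a _ => ?_)
        split_ifs <;> simp
    _ = _ := by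
        rw [Finset.sum_comm]
        simp only [Finset.sum_comm (s := (Finset.univ : Finset O)), Finset.sum_ite_eq,
          Finset.mem_univ, if_true]
        rw [Finset.sum_comm]

lemma TraceBound.uniform_fst {Δ : A → Op H} {c : ℝ} (hc : 0 ≤ c) (h : TraceBound Δ c) :
    TraceBound (fun p : O × A => ((Fintype.card O : ℂ)⁻¹) • Δ p.2) c := by
  refine ⟨fun {ι} _ {e f} he hf => ?_⟩
  have h2 : ∀ o : O, ∑ a, ∑ i, ‖inner ℂ (f (o, a) i) (((Fintype.card O : ℂ)⁻¹ • Δ a) (e (o, a) i))‖ ≤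
      (Fintype.card O : ℝ)⁻¹ * c := by
    intro o
    have := h.sum_le (fun a => he (o, a)) (fun a => hf (o, a))
    simp only [smul_apply, inner_smul_right, norm_mul, ← Finset.mul_sum]
    simpa using mul_le_mul_of_nonneg_left this (by positivity)
  rw [Fintype.sum_prod_type]
  refine (Finset.sum_le_sum fun o _ => h2 o).trans ?_
  simp only [Finset.sum_const, Finset.card_univ, nsmul_eq_mul, ← mul_assoc]
  exact mul_le_of_le_one_left hc mul_inv_le_one

/-- Bessel families in the separate blocks `x`, placed side by side, form one Bessel family of the
direct sum. -/
lemma TraceBound.uncurry {X : Type} [Fintype X] {Δ : A × X → Op H} {c : ℝ}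
    (h : TraceBound (fun a => cqOp fun x => Δ (a, x)) c) : TraceBound Δ c := by
  classical
  refine ⟨fun {ι} _ {e f} he hf => ?_⟩
  have hB : ∀ {e : A × X → ι → H}, (∀ p, IsBessel (e p)) → ∀ a,
      IsBessel fun p : X × ι => (PiLp.single 2 p.1 (e (a, p.1) p.2) : Joint X H) := by
    intro e he a v
    rw [Fintype.sum_prod_type, PiLp.norm_sq_eq_of_L2]
    simp only [inner_single_left]
    exact Finset.sum_le_sum fun x _ => he (a, x) (v x)
  have h2 := h.sum_le (hB he) (hB hf)
  simp only [inner_single_left, Fintype.sum_prod_type] at h2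
  rw [Fintype.sum_prod_type]
  simpa using h2

end TraceBound

/-! ### Compression and leftover hashing against quantum side information -/

section Compression

/-- The compression of an operator to a finite-dimensional subspace. -/
noncomputable def compress (K : Submodule ℂ H) [FiniteDimensional ℂ K] :
    Op H →ₗ[ℝ] (K →ₗ[ℂ] K) where
  toFun T := (K.orthogonalProjectionOnto ∘L T ∘L K.subtypeL : K →L[ℂ] K)
  map_add' S T := by ext v; simp
  map_smul' c T := by ext v; simp [← Complex.coe_smul]

variable (K : Submodule ℂ H) [FiniteDimensional ℂ K]

lemma inner_compress (T : Op H) (v w : K) :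
    inner ℂ v (compress K T w) = inner ℂ (v : H) (T w) := by
  simp [compress]

lemma isPositive_compress {T : Op H} (hT : T.IsPositive) : (compress K T).IsPositive :=
  (ContinuousLinearMap.isPositive_toLinearMap_iff _).2 (hT.orthogonalProjectionOnto_comp K)

lemma map_maskDeviation {V W : Type*} [AddCommGroup V] [Module ℝ V] [AddCommGroup W] [Module ℝ W]
    {N m : ℕ} {Y : Type*} [Fintype Y] [DecidableEq Y] (L : V →ₗ[ℝ] W)
    (w : Bits (N - m) → Y → Bits N) (F : Bits N → V) (p : Bits N × Y) :
    L (maskDeviation w F p) = maskDeviation w (fun x => L (F x)) p := by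
  simp only [maskDeviation, map_sub, map_smul, map_sum, apply_ite L, map_zero]

end Compression

/-- Leftover hashing against quantum side information, for dual universal masks. -/
theorem IsDualUniversal.traceBound_maskDeviation {N m : ℕ} (hm : m ≤ N) {Y : Type*} [Fintype Y]
    [Nonempty Y] [DecidableEq Y] {w : Bits (N - m) → Y → Bits N} (hw : IsDualUniversal w)
    {ρ : Bits N → Op H} (hρ : IsSubState ρ) {σ : Op H} (hσ : IsSubDensity σ) {l : ℝ} (hl : 0 < l)
    (hle : ∀ x, ρ x ≤ (l : ℂ) • σ) {s : ℝ} (hs : 0 < s) (hls : 2 ^ m * l ≤ 2 * s ^ 2) :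
    TraceBound (maskDeviation w ρ) (2 * s) := by
  refine ⟨fun {ι} _ {e f} he hf => ?_⟩
  -- The span of all test vectors is finite-dimensional, and compressing to it changes none of the
  -- tested matrix elements.
  set G : Set H := Set.range (fun p : (Bits N × Y) × ι => e p.1 p.2) ∪
    Set.range (fun p : (Bits N × Y) × ι => f p.1 p.2) with hG
  set K := Submodule.span ℂ G with hK
  have : FiniteDimensional ℂ K := FiniteDimensional.span_of_finite ℂ (Set.toFinite G)
  have heK : ∀ a i, e a i ∈ K := fun a i => Submodule.subset_span (Or.inl ⟨(a, i), rfl⟩)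
  have hfK : ∀ a i, f a i ∈ K := fun a i => Submodule.subset_span (Or.inr ⟨(a, i), rfl⟩)
  let b := stdOrthonormalBasis ℂ K
  have hb : Orthonormal ℂ fun j => (b j : H) := b.orthonormal.comp_linearIsometry K.subtypeₗᵢ
  obtain ⟨σ', τ, hσ', hτ, hστ, hdom, htr⟩ := exists_invertible_dominating b
    (isPositive_compress K hσ.isPositive) (by simpa only [inner_compress] using hσ.trace_le hb)
  have hform : ∑ x, weightedForm b τ (compress K (ρ x)) (compress K (ρ x)) ≤ l := by
    have h1 : ∀ x, weightedForm b τ (compress K (ρ x)) (compress K (ρ x)) ≤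
        l * ∑ j, (inner ℂ (b j : H) (ρ x (b j))).re := by
      intro x
      simp only [← inner_compress]
      refine weightedForm_le b (isPositive_compress K (hρ.isPositive x)) hστ hl fun v => ?_
      refine le_trans ?_ (mul_le_mul_of_nonneg_left (hdom v) hl.le)
      rw [inner_compress, inner_compress]
      have h := ((ContinuousLinearMap.le_def _ _).1 (hle x)).re_inner_nonneg_right (v : H)
      simpa [inner_sub_right, inner_smul_right, -Complex.coe_smul] using h
    refine (Finset.sum_le_sum fun x _ => h1 x).trans ?_
    rw [← Finset.mul_sum]
    exact mul_le_of_le_one_right hl.le (hρ.trace_le hb)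
  have hA : (0 : ℝ) < Fintype.card (Bits N × Y) := by exact_mod_cast Fintype.card_pos
  -- The parameter `t = s / n`, with `n` the number of blocks, balances the two terms: `s Tr σ' ≤ 2
  -- s` and `2^m l / s ≤ 2 s`.
  have hcs := sum_norm_inner_le b hσ' hτ hστ (fun a => compress K (maskDeviation w ρ a))
    (e := fun a i => ⟨e a i, heK a i⟩) (f := fun a i => ⟨f a i, hfK a i⟩)
    (fun a v => he a v) (fun a v => hf a v) (div_pos hs hA)
  have hmap : ∀ a, compress K (maskDeviation w ρ a) =
      maskDeviation w (fun x => compress K (ρ x)) a :=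
    fun a => map_maskDeviation (compress K) w ρ a
  simp only [inner_compress] at hcs
  have hhash := sum_maskDeviation_le hm hw (weightedForm b τ)
    (fun T => by
      rw [weightedForm_apply]
      exact Finset.sum_nonneg fun j _ => hτ.re_inner_nonneg_right (T (b j))) (fun x => compress K (ρ x))
  simp only [← hmap] at hhash
  set n : ℝ := (Fintype.card (Bits N × Y) : ℝ)
  have h1 : (s / n)⁻¹ * ∑ a, weightedForm b τ (compress K (maskDeviation w ρ a))
      (compress K (maskDeviation w ρ a)) ≤ 2 * s := by
    calc _ ≤ (s / n)⁻¹ * (2 ^ m / n * l) := by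
          refine mul_le_mul_of_nonneg_left (hhash.trans ?_) (by positivity)
          exact mul_le_mul_of_nonneg_left hform (by positivity)
      _ = (2 ^ m * l) / s := by field_simp
      _ ≤ 2 * s := by rw [div_le_iff₀ hs]; linarith
  have h2 : s / n * (n * ∑ j, (inner ℂ (b j) (σ' (b j))).re) ≤ 2 * s := by
    calc _ = s * ∑ j, (inner ℂ (b j) (σ' (b j))).re := by field_simp
      _ ≤ s * 2 := by gcongr
      _ = _ := mul_comm _ _
  linarith

/-! ### Dual universality: a counting criterion and Toeplitz masks -/

/-- The number of common zeros of a linear family of affine forms whose linear parts do not vanish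
identically. -/
lemma card_forall_eq_zero_mul_le {k d : ℕ} (φ : Bits k → Bits d → ZMod 2)
    (hr : ∀ r r' y, φ (r + r') y = φ r y + φ r' y)
    (hy : ∀ r y y', φ r (y + y') + φ r 0 = φ r y + φ r y')
    (hnd : ∀ r, r ≠ 0 → ∃ y, φ r y ≠ φ r 0) :
    Nat.card {y // ∀ r, φ r y = 0} * 2 ^ k ≤ Fintype.card (Bits d) := by
  classical
  have h0 : ∀ y, φ 0 y = 0 := fun y => by simpa using hr 0 0 y
  have h1 : ∀ y, ∑ r, signChar (φ r y) = if ∀ r, φ r y = 0 then (2 : ℝ) ^ k else 0 := by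
    intro y
    have h := sum_signChar_comp (AddMonoidHom.mk' (fun r => φ r y) fun r r' => hr r r' y)
    simpa using h
  have h2 : ∀ r, ∑ y, signChar (φ r y) = if r = 0 then (2 : ℝ) ^ d else 0 := by
    intro r
    by_cases h : r = 0
    · simp [h, h0]
    have hs := sum_signChar_comp (AddMonoidHom.mk' (fun y => φ r y - φ r 0) fun y y' => by
      linear_combination hy r y y')
    have hne : ¬ ∀ y, φ r y - φ r 0 = 0 := by
      obtain ⟨y, hy⟩ := hnd r h
      exact fun h' => hy (sub_eq_zero.1 (h' y))
    simp only [AddMonoidHom.mk'_apply, if_neg hne] at hs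
    rw [if_neg h]
    have : ∀ y, signChar (φ r y) = signChar (φ r y - φ r 0) * signChar (φ r 0) := fun y => by
      rw [← AddChar.map_add_eq_mul, sub_add_cancel]
    rw [Finset.sum_congr rfl fun y _ => this y, ← Finset.sum_mul, hs, zero_mul]
  -- Double counting of the character sum over all `(y, r)`: summed over `r` first it counts common
  -- zeros; summed over `y` first only `r = 0` survives.
  have h3 : (Nat.card {y // ∀ r, φ r y = 0} : ℝ) * 2 ^ k = 2 ^ d := by
    have := Finset.sum_comm (s := Finset.univ) (t := Finset.univ)
      (f := fun y r => signChar (φ r y))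
    simp only [h1, h2] at this
    rw [← Finset.sum_filter, Finset.sum_const, nsmul_eq_mul] at this
    rw [Nat.card_eq_fintype_card, Fintype.card_subtype, this]
    simp
  refine le_of_eq ?_
  have : (Fintype.card (Bits d) : ℝ) = 2 ^ d := by simp
  rw [← this] at h3
  exact_mod_cast h3

section Toeplitz

lemma dotProduct_modifiedToeplitzMask {n m : ℕ} (hm : m ≤ n) (a : Bits n) (r : Bits (n - m))
    (y : Bits (n - 1)) :
    a ⬝ᵥ modifiedToeplitzMask n m hm r y =
      r ⬝ᵥ (toeplitzBlock n m y *ᵥ fun i =>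
        a (finSumFinEquiv.trans (finCongr (Nat.add_sub_of_le hm)) (Sum.inl i))) +
      r ⬝ᵥ fun i => a (finSumFinEquiv.trans (finCongr (Nat.add_sub_of_le hm)) (Sum.inr i)) := by
  set E := finSumFinEquiv.trans (finCongr (Nat.add_sub_of_le hm))
  have h1 : a ⬝ᵥ modifiedToeplitzMask n m hm r y = (a ∘ E) ⬝ᵥ
      ((Matrix.fromCols (toeplitzBlock n m y) (1 : Matrix _ _ (ZMod 2)))ᵀ *ᵥ r) :=
    (dotProduct_comp_equiv_symm _ _ E)
  rw [h1, Matrix.mulVec_transpose, dotProduct_comm, ← Matrix.dotProduct_mulVec,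
    Matrix.fromCols_mulVec, dotProduct_add, Matrix.one_mulVec]
  rfl

lemma toeplitzBlock_add {n m : ℕ} (y y' : Bits (n - 1)) :
    toeplitzBlock n m (y + y') = toeplitzBlock n m y + toeplitzBlock n m y' := rfl

/-- With `i₀` the last index in the support of `r` and `j₀` the first in that of `a`, the difference
`j - i` is smallest at `(i₀, j₀)` and attained only there. Setting just this diagonal to one leaves
a single nonzero term. -/
lemma exists_dotProduct_toeplitzBlock_ne_zero {n m : ℕ} {r : Bits (n - m)} (hr : r ≠ 0)
    {a : Bits m} (ha : a ≠ 0) : ∃ y, r ⬝ᵥ (toeplitzBlock n m y *ᵥ a) ≠ 0 := by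
  classical
  obtain ⟨i₁, hi₁⟩ := Function.ne_iff.1 hr
  obtain ⟨j₁, hj₁⟩ := Function.ne_iff.1 ha
  obtain ⟨i₀, hi₀, hi⟩ := (Finset.univ.filter fun i => r i ≠ 0).exists_maximal
    ⟨i₁, by simpa using hi₁⟩
  obtain ⟨j₀, hj₀, hj⟩ := (Finset.univ.filter fun j => a j ≠ 0).exists_minimal
    ⟨j₁, by simpa using hj₁⟩
  simp only [Finset.mem_filter, Finset.mem_univ, true_and] at hi₀ hj₀ hi hj
  have hi' : ∀ i, r i ≠ 0 → i ≤ i₀ := fun i h => (le_total i i₀).elim id (hi h)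
  have hj' : ∀ j, a j ≠ 0 → j₀ ≤ j := fun j h => (le_total j₀ j).elim id (hj h)
  have hb : j₀.1 + (n - m - 1) - i₀.1 < n - 1 := by omega
  refine ⟨Pi.single ⟨j₀.1 + (n - m - 1) - i₀.1, hb⟩ 1, ?_⟩
  have hentry : ∀ i j, r i ≠ 0 → a j ≠ 0 →
      toeplitzBlock n m (Pi.single ⟨j₀.1 + (n - m - 1) - i₀.1, hb⟩ 1) i j ≠ 0 →
      i = i₀ ∧ j = j₀ := by
    intro i j h1 h2 h3
    have hle := hi' i h1
    have hle' := hj' j h2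
    rw [toeplitzBlock, Matrix.of_apply, Pi.single_apply] at h3
    have h4 : j.1 + (n - m - 1) - i.1 = j₀.1 + (n - m - 1) - i₀.1 := by
      by_contra h
      exact h3 (if_neg fun h' => h (congrArg Fin.val h'))
    rw [Fin.le_def] at hle hle'
    constructor <;> ext <;> omega
  rw [dotProduct, Finset.sum_eq_single i₀, Matrix.mulVec, dotProduct, Finset.sum_eq_single j₀]
  · refine mul_ne_zero hi₀ (mul_ne_zero ?_ hj₀)
    simp [toeplitzBlock]
  · intro j _ h
    by_contra h'
    exact h (hentry i₀ j hi₀ (right_ne_zero_of_mul h') (left_ne_zero_of_mul h')).2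
  · simp
  · intro i _ h
    by_contra h'
    have hsum : ∑ j, toeplitzBlock n m (Pi.single ⟨j₀.1 + (n - m - 1) - i₀.1, hb⟩ 1) i j * a j ≠ 0 :=
      right_ne_zero_of_mul h'
    obtain ⟨j, -, h''⟩ := Finset.exists_ne_zero_of_sum_ne_zero hsum
    exact h (hentry i j (left_ne_zero_of_mul h') (right_ne_zero_of_mul h'')
      (left_ne_zero_of_mul h'')).1
  · simp

theorem isDualUniversal_modifiedToeplitzMask {n m : ℕ} (hm : m ≤ n) :
    IsDualUniversal (modifiedToeplitzMask n m hm) where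
  map_add r r' y := by
    funext i
    simp [modifiedToeplitzMask, Matrix.mulVec_add]
  card_le a ha := by
    set E := finSumFinEquiv.trans (finCongr (Nat.add_sub_of_le hm)) with hE
    have hmask := dotProduct_modifiedToeplitzMask hm a
    -- If the first `m` bits of `a` vanish, the identity block shows that no dual code contains `a`.
    -- Otherwise the Toeplitz block gives a nonconstant form in `y`, which the identity block only
    -- translates.
    by_cases ha1 : (fun i => a (E (Sum.inl i))) = 0
    · have : IsEmpty {y // ∀ r, a ⬝ᵥ modifiedToeplitzMask n m hm r y = 0} := by
        refine ⟨fun ⟨y, hy⟩ => ha ?_⟩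
        have h2 : (fun i => a (E (Sum.inr i))) = 0 := by
          refine dotProduct_eq_zero _ fun r => ?_
          have := hy r
          rw [hmask, ha1, Matrix.mulVec_zero, dotProduct_zero, zero_add] at this
          rwa [dotProduct_comm]
        funext i
        obtain ⟨i, rfl⟩ := E.surjective i
        rcases i with i | i
        · exact congrFun ha1 i
        · exact congrFun h2 i
      simp
    · refine card_forall_eq_zero_mul_le _ (fun r r' y => ?_) (fun r y y' => ?_) fun r hr => ?_
      · simp only [hmask, add_dotProduct]
        ring
      · have h0 : toeplitzBlock n m 0 = 0 := rfl
        simp only [hmask, toeplitzBlock_add, Matrix.add_mulVec, dotProduct_add, h0,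
          Matrix.zero_mulVec, dotProduct_zero]
        ring
      · obtain ⟨y, hy⟩ := exists_dotProduct_toeplitzBlock_ne_zero hr ha1
        refine ⟨y, ?_⟩
        have h0 : toeplitzBlock n m 0 = 0 := rfl
        rw [hmask, hmask, h0]
        exact fun h => hy (by
          simpa only [Matrix.zero_mulVec, dotProduct_zero, zero_add, add_eq_right] using h)

end Toeplitz

/-! ### Dual universality of circulant masks -/

section Circulant

open Polynomial

lemma irreducible_cyclotomic_zmod_two {n : ℕ} (hn : n.Prime)
    (h2 : orderOf (2 : ZMod n) = n - 1) : Irreducible (cyclotomic n (ZMod 2)) := by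
  have hdvd : ¬ 2 ∣ n := by
    intro h
    have h' : n = 2 := ((Nat.prime_dvd_prime_iff_eq Nat.prime_two hn).1 h).symm
    subst h'
    have h20 : (2 : ZMod 2) = 0 := by decide
    rw [h20, orderOf_zero] at h2
    omega
  refine ZMod.irreducible_of_dvd_cyclotomic_of_natDegree hdvd dvd_rfl ?_
  rw [natDegree_cyclotomic, Nat.totient_prime hn, ← h2, ← orderOf_units]
  simp

/-- The value at `ζ` of the polynomial with coefficients `v`. -/
def evalBits {n : ℕ} {L : Type*} [CommRing L] [Algebra (ZMod 2) L] (ζ : L) (v : Bits n) : L :=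
  ∑ i, algebraMap (ZMod 2) L (v i) * ζ ^ (i : ℕ)

/-- Multiplication by a circulant matrix is cyclic convolution, that is, multiplication of
polynomials modulo `X^n - 1`. -/
lemma evalBits_mul {n : ℕ} [NeZero n] {L : Type*} [CommRing L] [Algebra (ZMod 2) L] {ζ : L}
    (hζ : ζ ^ n = 1) (a v : Bits n) :
    evalBits ζ a * evalBits ζ v = evalBits ζ (a ᵥ* circulantRows v) := by
  simp only [evalBits, Matrix.vecMul, dotProduct, map_sum]
  rw [Finset.sum_mul_sum]
  simp only [Finset.sum_mul]
  rw [Finset.sum_comm (s := Finset.univ) (t := Finset.univ)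
    (f := fun j i => algebraMap (ZMod 2) L (a i * circulantRows v i j) * ζ ^ (j : ℕ))]
  refine Finset.sum_congr rfl fun i _ => ?_
  rw [← (Equiv.subRight i).sum_comp]
  refine Finset.sum_congr rfl fun j _ => ?_
  have h : ζ ^ (j : ℕ) = ζ ^ (i : ℕ) * ζ ^ ((j - i : Fin n) : ℕ) := by
    have hj : (j : ℕ) = ((i : ℕ) + ((j - i : Fin n) : ℕ)) % n := by
      rw [← Fin.val_add, add_sub_cancel]
    rw [← pow_add, hj, ← pow_eq_pow_mod _ hζ]
  rw [h, map_mul]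
  simp only [Equiv.subRight_apply, circulantRows, Matrix.of_apply]
  ring

/-- The vanishing last bit brings the degree below `n - 1 = deg Φ_n`, so divisibility by `Φ_n`
forces zero. The masks meet this condition because both `a` and `r` are padded with at least one
zero. -/
lemma eq_zero_of_evalBits_root_eq_zero {n : ℕ} (hn : n.Prime) {v : Bits n}
    (hv : v ⟨n - 1, Nat.sub_lt hn.pos one_pos⟩ = 0)
    (h : evalBits (AdjoinRoot.root (cyclotomic n (ZMod 2))) v = 0) : v = 0 := by
  set P : (ZMod 2)[X] := ∑ i, C (v i) * X ^ (i : ℕ) with hP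
  have hmk : AdjoinRoot.mk (cyclotomic n (ZMod 2)) P = 0 := by
    rw [← h, hP, map_sum, evalBits]
    exact Finset.sum_congr rfl fun i _ => by rw [map_mul, map_pow]; rfl
  have hcoeff : ∀ i : Fin n, P.coeff i = v i := by
    intro i
    simp only [hP, finsetSum_coeff, coeff_C_mul, coeff_X_pow]
    rw [Finset.sum_eq_single i] <;> simp +contextual [Fin.ext_iff, eq_comm]
  have hdeg : P.degree < (cyclotomic n (ZMod 2)).degree := by
    rw [degree_cyclotomic, Nat.totient_prime hn, degree_lt_iff_coeff_zero]
    intro j hj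
    rcases hj.eq_or_lt with rfl | hj
    · exact (hcoeff ⟨n - 1, _⟩).trans hv
    · simp only [hP, finsetSum_coeff, coeff_C_mul, coeff_X_pow]
      refine Finset.sum_eq_zero fun i _ => ?_
      rw [if_neg (by omega), mul_zero]
  have hP0 : P = 0 := eq_zero_of_dvd_of_degree_lt (AdjoinRoot.mk_eq_zero.1 hmk) hdeg
  funext i
  rw [← hcoeff i, hP0, coeff_zero, Pi.zero_apply]

lemma root_cyclotomic_pow (n : ℕ) :
    AdjoinRoot.root (cyclotomic n (ZMod 2)) ^ n = 1 := by
  have h := AdjoinRoot.mk_eq_zero.2 (cyclotomic.dvd_X_pow_sub_one n (ZMod 2))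
  simpa [sub_eq_zero] using h

/-- Since `2` is a primitive root, `Φ_n` is irreducible over `𝔽₂`; both factors are nonzero in the
field `𝔽₂[X]/Φ_n`, hence so is their product. -/
lemma vecMul_circulantRows_ne_zero {n : ℕ} (hn : n.Prime)
    (h2 : orderOf (2 : ZMod n) = n - 1) {a v : Bits n} (ha : a ≠ 0) (hv : v ≠ 0)
    (ha' : a ⟨n - 1, Nat.sub_lt hn.pos one_pos⟩ = 0)
    (hv' : v ⟨n - 1, Nat.sub_lt hn.pos one_pos⟩ = 0) : a ᵥ* circulantRows v ≠ 0 := by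
  intro h
  have : Fact (Irreducible (cyclotomic n (ZMod 2))) := ⟨irreducible_cyclotomic_zmod_two hn h2⟩
  have : NeZero n := ⟨hn.ne_zero⟩
  have hmul := evalBits_mul (root_cyclotomic_pow n) a v
  rw [h] at hmul
  have h0 : evalBits (AdjoinRoot.root (cyclotomic n (ZMod 2))) (0 : Bits n) = 0 := by
    simp [evalBits]
  rw [h0] at hmul
  rcases mul_eq_zero.1 hmul with h | h
  · exact ha (eq_zero_of_evalBits_root_eq_zero hn ha' h)
  · exact hv (eq_zero_of_evalBits_root_eq_zero hn hv' h)

lemma padZeros_add {l n : ℕ} (r r' : Bits l) :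
    padZeros n (r + r') = padZeros n r + padZeros n r' := by
  funext i
  simp only [padZeros, Pi.add_apply]
  split_ifs <;> simp

lemma padZeros_ne_zero {l n : ℕ} (h : l ≤ n) {r : Bits l} (hr : r ≠ 0) : padZeros n r ≠ 0 := by
  obtain ⟨i, hi⟩ := Function.ne_iff.1 hr
  refine fun h' => hi ?_
  simpa [padZeros] using congrFun h' (Fin.castLE h i)

lemma dotProduct_firstBits {n m : ℕ} (h : m ≤ n) (a : Bits m) (v : Bits n) :
    a ⬝ᵥ firstBits h v = padZeros n a ⬝ᵥ v := by
  simp only [dotProduct, firstBits]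
  refine Finset.sum_of_injOn (Fin.castLE h) (Fin.castLE_injective h).injOn (by simp)
    (fun i _ hi => ?_) (fun i _ => by simp [padZeros])
  have : ¬ i.1 < m := fun h' => hi ⟨⟨i, h'⟩, by simp, rfl⟩
  simp [padZeros, this]

theorem isDualUniversal_circulantMask {n m : ℕ} (hm : m ≤ n - 1) (hn : n.Prime)
    (h2 : orderOf (2 : ZMod n) = n - 1) : IsDualUniversal (circulantMask n m) where
  map_add r r' y := by
    have : circulantRows (padZeros n (r + r')) =
        circulantRows (padZeros n r) + circulantRows (padZeros n r') := by
      rw [padZeros_add]; rfl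
    simp only [circulantMask, this, Matrix.add_mulVec]
    rfl
  card_le a ha := by
    have hmask : ∀ r y, a ⬝ᵥ circulantMask n m r y =
        (padZeros n a ᵥ* circulantRows (padZeros n r)) ⬝ᵥ y := fun r y => by
      rw [circulantMask, dotProduct_firstBits, Matrix.dotProduct_mulVec]
    refine card_forall_eq_zero_mul_le _ (fun r r' y => ?_) (fun r y y' => ?_) fun r hr => ?_
    · have : circulantRows (padZeros n (r + r')) =
          circulantRows (padZeros n r) + circulantRows (padZeros n r') := by
        rw [padZeros_add]; rfl
      simp only [hmask, this, Matrix.vecMul_add, add_dotProduct]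
    · simp only [hmask, dotProduct_add, dotProduct_zero, add_zero]
    · have hne := vecMul_circulantRows_ne_zero hn h2 (padZeros_ne_zero (Nat.sub_le n 1) ha)
        (padZeros_ne_zero (n := n) (by omega) hr) (by simp [padZeros])
        (by simp only [padZeros]; rw [dif_neg (by omega)])
      simp only [hmask, dotProduct_zero]
      by_contra! h
      exact hne (dotProduct_eq_zero _ h)

end Circulant

/-! ### Classical post-processing of seeded states -/

section Pushforward

variable {X S A O : Type} [Fintype X] [Fintype S] [Fintype A]

lemma pushforward_sub [DecidableEq O] (g : A → O) (Δ Δ' : A → Op H) :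
    pushforward g (fun a => Δ a - Δ' a) = fun o => pushforward g Δ o - pushforward g Δ' o := by
  funext o
  simp only [pushforward, ← Finset.sum_sub_distrib]
  exact Finset.sum_congr rfl fun a _ => by split_ifs <;> simp

lemma pushforward_seeded [DecidableEq A] [DecidableEq O] (ρ : X → Op H) (g : X → S → A) (h : A → O) :
    pushforward h (seeded ρ g) = seeded ρ (fun x s => h (g x s)) := by
  funext o
  have hite : ∀ a, (if h a = o then seeded ρ g a else 0) = ∑ x, ∑ s, if g x s = a then
      (if h a = o then ((Fintype.card S : ℂ)⁻¹) • ρ x else 0) else 0 := fun a => by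
    split_ifs <;> simp [seeded]
  simp only [pushforward, hite]
  rw [seeded]
  rw [Finset.sum_comm]
  refine Finset.sum_congr rfl fun x _ => ?_
  rw [Finset.sum_comm]
  exact Finset.sum_congr rfl fun s _ => by rw [Finset.sum_ite_eq, if_pos (Finset.mem_univ _)]

lemma pushforward_uniformWith_of_bijective [Fintype O] [DecidableEq A] [DecidableEq O] (τ : Op H) {h : A → O} (hh : h.Bijective) :
    pushforward h (uniformWith A τ) = uniformWith O τ := by
  funext o
  obtain ⟨a, rfl⟩ := hh.2 o
  simp only [pushforward, uniformWith, hh.1.eq_iff, Finset.sum_ite_eq', Finset.mem_univ, if_true,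
    Fintype.card_of_bijective hh]

lemma pushforward_fst_uniformWith [DecidableEq A] [Fintype O] [Nonempty O] (τ : Op H) :
    pushforward (Prod.fst : A × O → A) (uniformWith (A × O) τ) = uniformWith A τ := by
  funext a
  have hO : (Fintype.card O : ℂ) ≠ 0 := by exact_mod_cast Fintype.card_ne_zero
  simp only [pushforward, uniformWith, Fintype.sum_prod_type]
  rw [Finset.sum_eq_single a]
  · simp only [if_true, Finset.sum_const, Finset.card_univ, Fintype.card_prod, Nat.cast_mul]
    rw [← Nat.cast_smul_eq_nsmul ℂ, smul_smul]
    congr 1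
    field_simp
  · intro b _ hb
    simp [hb]
  · simp

end Pushforward

/-! ### From masks to stream extractors -/

section Stream

variable {N m d : ℕ}

/-- Splitting a bit string into its first and its last bits. -/
lemma bijective_split (hm : m ≤ N) : Function.Bijective fun p : Bits N × Bits d =>
    (firstBits hm p.1, (lastBits hm p.1, p.2)) := by
  rw [Fintype.bijective_iff_injective_and_card]
  constructor
  · rintro ⟨u, y⟩ ⟨u', y'⟩ h
    simp only [Prod.mk.injEq] at h ⊢
    refine ⟨funext fun i => ?_, h.2.2⟩
    by_cases hi : i.1 < m
    · exact congrFun h.1 ⟨i, hi⟩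
    · have := congrFun h.2.1 ⟨i - m, by omega⟩
      simpa [lastBits, Nat.add_sub_cancel' (not_lt.1 hi)] using this
  · simp only [Fintype.card_prod, Fintype.card_fun, Fintype.card_fin, ZMod.card]
    simp only [← pow_add]
    congr 1
    omega

lemma maskDeviation_eq {Y : Type} [Fintype Y] [DecidableEq Y] (w : Bits (N - m) → Y → Bits N)
    (ρ : Bits N → Op H) :
    maskDeviation w ρ = fun p => seeded ρ (fun x (s : Bits (N - m) × Y) => (x + w s.1 s.2, s.2)) p -
      uniformWith (Bits N × Y) (marginal ρ) p := by
  funext p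
  simp only [maskDeviation, seeded, uniformWith, marginal, ← Complex.coe_smul]
  push_cast
  rfl

/-- The joint deviation from uniformity of output and outgoing seed of a stream extractor. -/
theorem IsDualUniversal.traceBound_stream (hm : m ≤ N) {w : Bits (N - m) → Bits d → Bits N}
    (hw : IsDualUniversal w) {ρ : Bits N → Op H} (hρ : IsSubState ρ) {k : ℝ}
    (hk : k ≤ condMinEntropy ρ) :
    TraceBound (fun a => seeded ρ (fun x s => (streamExt hm w x s, streamNextSeed hm w x s)) a -
      uniformWith (Bits m × (Bits (N - m) × Bits d)) (marginal ρ) a)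
      (2 * (2 : ℝ) ^ (((m : ℝ) - k) / 2)) := by
  obtain ⟨σ, l, hσ, hl, hle⟩ := hρ.exists_le_smul hk
  have hs : ((2 : ℝ) ^ (((m : ℝ) - k) / 2)) ^ 2 = 2 ^ ((m : ℝ) - k) := by
    rw [← Real.rpow_natCast, ← Real.rpow_mul zero_le_two]
    congr 1
    push_cast
    ring
  -- The size condition reads `2^(m-l) ≤ 2 · 2^(m-k)`; here the bit lost in `k - 1 < l` is absorbed.
  have h := hw.traceBound_maskDeviation hm hρ hσ (l := 2 ^ (-l)) (by positivity) hle
    (s := (2 : ℝ) ^ (((m : ℝ) - k) / 2)) (by positivity) (by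
      rw [hs, ← Real.rpow_natCast, ← Real.rpow_add two_pos]
      calc _ ≤ (2 : ℝ) ^ (1 + ((m : ℝ) - k)) :=
            Real.rpow_le_rpow_of_exponent_le one_le_two (by linarith)
        _ = _ := by rw [Real.rpow_add two_pos, Real.rpow_one])
  have h2 := h.pushforward fun p : Bits N × Bits d =>
    (firstBits hm p.1, (lastBits hm p.1, p.2))
  rw [maskDeviation_eq, pushforward_sub, pushforward_seeded,
    pushforward_uniformWith_of_bijective _ (bijective_split hm)] at h2
  exact h2

lemma traceDist_le_of_traceBound {A : Type} [Fintype A] {Δ Δ' : A → Op H} {c : ℝ}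
    (h : TraceBound (fun a => Δ a - Δ' a) (2 * c)) : traceDist Δ Δ' ≤ ENNReal.ofReal c := by
  rw [traceDist, cqOp_sub]
  calc _ ≤ 2⁻¹ * ENNReal.ofReal (2 * c) := by gcongr; exact h.traceNorm_le
    _ = _ := by
      rw [ENNReal.ofReal_mul zero_le_two, ← mul_assoc]
      simp [ENNReal.inv_mul_cancel]

theorem IsDualUniversal.isQuantumProofStrongExtractor (hm : m ≤ N)
    {w : Bits (N - m) → Bits d → Bits N} (hw : IsDualUniversal w) (k : ℝ) :
    IsQuantumProofStrongExtractor.{u} (streamExt hm w) (streamNextSeed hm w) k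
      ((2 : ℝ) ^ (((m : ℝ) - k) / 2)) := by
  intro H _ _ _ ρ hρ hk
  exact traceDist_le_of_traceBound (hw.traceBound_stream hm hρ.isSubState hk)

theorem IsDualUniversal.isQuantumProofExtractor (hm : m ≤ N)
    {w : Bits (N - m) → Bits d → Bits N} (hw : IsDualUniversal w) (k : ℝ) :
    IsQuantumProofExtractor.{u} (streamExt hm w) k ((2 : ℝ) ^ (((m : ℝ) - k) / 2)) := by
  intro H _ _ _ ρ hρ hk
  have h := (hw.traceBound_stream hm hρ.isSubState hk).pushforward Prod.fst
  rw [pushforward_sub, pushforward_seeded, pushforward_fst_uniformWith] at h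
  exact traceDist_le_of_traceBound h

/-! ### Re-use of the seed -/

section Reuse

variable {X₁ X₂ S Z O : Type} [Fintype X₁] [Fintype X₂] [Fintype S] [Fintype Z]
  [DecidableEq Z] [DecidableEq S] [DecidableEq O]

/-- A deterministic second round after a first round with side information `X₂`. -/
lemma pushforward_first_round (ρ : X₁ × X₂ → Op H) (g : X₁ → S → Z × S) (g' : X₂ → S → O) :
    pushforward (fun p : (Z × S) × X₂ => (p.1.1, g' p.2 p.1.2)) (fun p =>
      seeded (fun x₁ => ρ (x₁, p.2)) g p.1 - uniformWith (Z × S) (∑ x₁, ρ (x₁, p.2)) p.1) =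
    fun o => seeded ρ (fun x s => ((g x.1 s).1, g' x.2 (g x.1 s).2)) o -
      ((Fintype.card Z : ℂ)⁻¹) • seeded (fun x₂ => ∑ x₁, ρ (x₁, x₂)) g' o.2 := by
  classical
  have h₁ : (fun p : (Z × S) × X₂ => seeded (fun x₁ => ρ (x₁, p.2)) g p.1) =
      seeded ρ (fun x s => (g x.1 s, x.2)) := by
    funext p
    simp only [seeded, Fintype.sum_prod_type]
    refine Finset.sum_congr rfl fun x₁ _ => ?_
    rw [Finset.sum_eq_single p.2]
    · simp [Prod.ext_iff]
    · intro x₂ _ hx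
      simp [Prod.ext_iff, hx]
    · simp
  rw [pushforward_sub, h₁, pushforward_seeded]
  funext o
  congr 1
  simp only [pushforward, uniformWith, seeded, Fintype.sum_prod_type, Prod.ext_iff]
  rw [Finset.sum_eq_single o.1]
  · rw [Finset.sum_comm]
    simp only [true_and, Finset.smul_sum, smul_ite, smul_zero, smul_smul, Fintype.card_prod,
      Nat.cast_mul, mul_inv]
  · intro z _ hz
    simp [hz]
  · simp

/-- Hybrid argument. By the first round with side information `X₂E`, the pair `(Z₁, S')` may be
replaced by a uniform one, and running the second round on it costs nothing more. That round then
uses a fresh seed, and the two errors add up. -/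
theorem isSecureUnderSeedReuse_of_traceBound [Nonempty Z] [Nonempty S]
    {ext : X₁ → S → Z} {next : X₁ → S → S} {k c : ℝ} (hc : 0 ≤ c)
    (h : ∀ (H : Type u) [NormedAddCommGroup H] [InnerProductSpace ℂ H] (ρ : X₁ → Op H),
      IsSubState ρ → k ≤ condMinEntropy ρ →
      TraceBound (fun a => seeded ρ (fun x s => (ext x s, next x s)) a -
        uniformWith (Z × S) (marginal ρ) a) (2 * c)) :
    IsSecureUnderSeedReuse.{u} ext next k (2 * c) := by
  intro H _ _ _ ρ hρ hk₁ hk₂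
  refine traceDist_le_of_traceBound ?_
  have h₁ := h _ _ hρ.isSubState_curry hk₁
  have h₂ := h _ _ hρ.isSubState.sum_fst hk₂
  have e₁ : (fun a => seeded (fun x₁ => cqOp fun x₂ => ρ (x₁, x₂))
        (fun x s => (ext x s, next x s)) a -
        uniformWith (Z × S) (marginal fun x₁ => cqOp fun x₂ => ρ (x₁, x₂)) a) =
      fun a => cqOp fun x₂ => seeded (fun x₁ => ρ (x₁, x₂)) (fun x s => (ext x s, next x s)) a -
        uniformWith (Z × S) (∑ x₁, ρ (x₁, x₂)) a := by
    funext a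
    rw [← cqOp_sub]
    congr 1
    · ext v x₂
      simp only [seeded, sum_apply, WithLp.ofLp_sum, Finset.sum_apply, cqOp_apply]
      refine Finset.sum_congr rfl fun x _ => Finset.sum_congr rfl fun s _ => ?_
      split_ifs <;> simp
    · ext v x₂
      simp [uniformWith, marginal]
  rw [e₁] at h₁
  have h₃ := (TraceBound.uncurry (Δ := fun p : (Z × S) × X₁ =>
    seeded (fun x₁ => ρ (x₁, p.2)) (fun x s => (ext x s, next x s)) p.1 -
      uniformWith (Z × S) (∑ x₁, ρ (x₁, p.2)) p.1) h₁).pushforward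
        (fun p => (p.1.1, (ext p.2 p.1.2, next p.2 p.1.2)))
  rw [pushforward_first_round ρ (fun x s => (ext x s, next x s))
    (fun x s => (ext x s, next x s))] at h₃
  -- Triangle inequality through the hybrid state: uniform `Z₁` next to a second round run with a
  -- fresh seed.
  have h₄ := h₃.add (h₂.uniform_fst (O := Z) (by positivity))
  convert h₄ using 1
  · funext o
    have : uniformWith (Z × Z × S) (marginal ρ) o = (Fintype.card Z : ℂ)⁻¹ •
        uniformWith (Z × S) (marginal fun x₂ => ∑ x₁, ρ (x₁, x₂)) o.2 := by
      simp only [uniformWith, marginal, Fintype.sum_prod_type_right, Fintype.card_prod,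
        Nat.cast_mul, smul_smul, mul_inv]
    rw [this, smul_sub]
    abel
  · ring

end Reuse

end Stream

end StreamExtraction

theorem mainTheorem1 :
    (∀ (n m : ℕ) (hm : m ≤ n - 1) (k : ℝ), n.Prime → orderOf (2 : ZMod n) = n - 1 →
      IsQuantumProofExtractor.{u} (StreamC n m hm) k ((2 : ℝ) ^ (((m : ℝ) - k) / 2)) ∧
      IsQuantumProofStrongExtractor.{u} (StreamC n m hm) (StreamCNextSeed n m hm) k
        ((2 : ℝ) ^ (((m : ℝ) - k) / 2)) ∧
      IsSecureUnderSeedReuse.{u} (StreamC n m hm) (StreamCNextSeed n m hm) k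
        (2 * (2 : ℝ) ^ (((m : ℝ) - k) / 2))) ∧
    (∀ (n m : ℕ) (hm : m ≤ n) (k : ℝ), 1 ≤ n →
      IsQuantumProofExtractor.{u} (StreamM n m hm) k ((2 : ℝ) ^ (((m : ℝ) - k) / 2)) ∧
      IsQuantumProofStrongExtractor.{u} (StreamM n m hm) (StreamMNextSeed n m hm) k
        ((2 : ℝ) ^ (((m : ℝ) - k) / 2)) ∧
      IsSecureUnderSeedReuse.{u} (StreamM n m hm) (StreamMNextSeed n m hm) k
        (2 * (2 : ℝ) ^ (((m : ℝ) - k) / 2))) := by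
  have key : ∀ {N m d : ℕ} (hm : m ≤ N) {w : Bits (N - m) → Bits d → Bits N}
      (_ : IsDualUniversal w) (k : ℝ),
      IsQuantumProofExtractor.{u} (streamExt hm w) k ((2 : ℝ) ^ (((m : ℝ) - k) / 2)) ∧
      IsQuantumProofStrongExtractor.{u} (streamExt hm w) (streamNextSeed hm w) k
        ((2 : ℝ) ^ (((m : ℝ) - k) / 2)) ∧
      IsSecureUnderSeedReuse.{u} (streamExt hm w) (streamNextSeed hm w) k
        (2 * (2 : ℝ) ^ (((m : ℝ) - k) / 2)) := fun hm w hw k =>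
    ⟨hw.isQuantumProofExtractor hm k, hw.isQuantumProofStrongExtractor hm k,
      isSecureUnderSeedReuse_of_traceBound (by positivity)
        fun _ _ _ _ hρ hk => hw.traceBound_stream hm hρ hk⟩
  exact ⟨fun n m hm k hn h2 => key hm (isDualUniversal_circulantMask hm hn h2) k,
    fun n m hm k _ => key hm (isDualUniversal_modifiedToeplitzMask hm) k⟩
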